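/- Let $\mathbb{D}$ be the unit disc, $dA=\frac{dx\,dy}{\pi}$, and let $\omega$ be a radial weight on $\mathbb{D}$, that is, a nonnegative integrable function with $\omega(z)=\omega(|z|)$. Write $\widehat{\omega}(r)=\int_r^1\omega(s)\,ds$ and assume that $\omega\in\widehat{\mathcal D}$, that is, $\widehat\omega(r)>0$ for all $0\le r<1$ and there is a constant $C$ with $\widehat{\omega}(r)\le C\,\widehat{\omega}\left(\frac{1+r}{2}\right)$ for all $0\le r<1$. Let $\omega^\star(z)=\int_{|z|}^1\omega(s)\log\frac{s}{|z|}\,s\,ds$ for $z\in\mathbb{D}\setminus\{0\}$. Let $A^2_\omega$ be the Hilbert space of analytic functions $f$ in $\mathbb{D}$ with $\|f\|_{A^2_\omega}^2=\int_{\mathbb D}|f|^2\omega\,dA<\infty$, let $B_z^\omega$ be its reproducing kernel at $z\in\mathbb{D}$, and for a bounded linear operator $T$ on $A^2_\omega$ let $$\widetilde T(z)=\frac{\langle T B^\omega_z,B^\omega_z\rangle_{A^2_\omega}}{\|B^\omega_z\|^2_{A^2_\omega}},\qquad z\in\mathbb{D},$$ be its Berezin transform. Then a bounded positive operator $T:A^2_\omega\to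 A^2_\omega$ belongs to the trace class $\mathcal S_1(A^2_\omega)$ (that is, $T$ is compact and its singular values $\lambda_n(T)=\inf\{\|T-R\|:\operatorname{rank}R\le n\}$, $n\ge 0$, satisfy $\sum_n\lambda_n(T)<\infty$) if and only if $\widetilde T\in L^1\left(\mathbb{D},\frac{\omega}{\omega^\star}\,dA\right)$. Moreover, for each bounded positive operator $T$ on $A^2_\omega$, the trace $\operatorname{tr}(T)=\sum_n\langle Te_n,e_n\rangle_{A^2_\omega}\in[0,\infty]$, where $\{e_n\}$ is any orthonormal basis of $A^2_\omega$, satisfies $$\operatorname{tr}(T)=\int_{\mathbb D}\widetilde T(z)\,\|B^\omega_z\|^2_{A^2_\omega}\,\omega(z)\,dA(z)\asymp\int_{\mathbb D}\widetilde T(z)\,\frac{\omega(z)}{\omega^\star(z)}\,dA(z),$$ where the constants of comparison depend only on $\omega$. In particular both integrals are finite when $T$ is of trace class. -/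

import Mathlib

open MeasureTheory
open scoped ENNReal NNReal

noncomputable section

namespace Bergman

/-! ### Radial weights -/

/-- The open unit disc of the complex plane. -/
def disc : Set ℂ := Metric.ball (0 : ℂ) 1

/-- The normalized area measure `dA = dx dy / π` on the unit disc. -/
def area : Measure ℂ := ENNReal.ofReal (1 / Real.pi) • (volume : Measure ℂ).restrict disc

/-- `ω : ℝ → ℝ` is the profile of a radial weight: the function `z ↦ ω |z|` is nonnegative and
integrable on the unit disc. (Values of `ω` outside `[0, 1)` play no role.) -/
structure IsRadialWeight (ω : ℝ → ℝ) : Prop where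
  nonneg : ∀ r, 0 ≤ r → r < 1 → 0 ≤ ω r
  integrable : IntegrableOn (fun z : ℂ => ω ‖z‖) disc volume

/-- The tail integral `∫_r^1 ω(s) ds`, with values in `[0, ∞]`. -/
def tail (ω : ℝ → ℝ) (r : ℝ) : ℝ≥0∞ := ∫⁻ s in Set.Ioo r 1, ENNReal.ofReal (ω s)

/-- The class of doubling radial weights, with the standing assumption that the tail integral
is strictly positive on `[0, 1)` (it fails only for the weights that vanish almost everywhere). -/
structure IsDoubling (ω : ℝ → ℝ) : Prop extends IsRadialWeight ω where
  tail_pos : ∀ r, 0 ≤ r → r < 1 → 0 < tail ω r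
  doubling : ∃ C : ℝ≥0, ∀ r, 0 ≤ r → r < 1 → tail ω r ≤ C * tail ω ((1 + r) / 2)

/-- The associated weight `ω⋆(z) = ∫_{|z|}^1 ω(s) log (s / |z|) s ds` for `0 < |z| < 1`. -/
def omegaStar (ω : ℝ → ℝ) (z : ℂ) : ℝ := ∫ s in Set.Ioo ‖z‖ 1, ω s * Real.log (s / ‖z‖) * s

/-- The measure `ω dA` on the unit disc. -/
def weightMeasure (ω : ℝ → ℝ) : Measure ℂ :=
  area.withDensity fun z => ENNReal.ofReal (ω ‖z‖)

/-- The measure `(ω / ω⋆) dA` on the unit disc. -/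
def quotientMeasure (ω : ℝ → ℝ) : Measure ℂ :=
  area.withDensity fun z => ENNReal.ofReal (ω ‖z‖ / omegaStar ω z)

/-! ### The weighted Bergman space and its reproducing kernels -/

/-- The weighted Bergman space `A²_ω`, as the subspace of `L²(ω dA)` of the functions that are
represented by an analytic function in the unit disc. Its inner product is
`∫ f conj(g) ω dA`, which is written `inner ℂ g f` in Mathlib. -/
def A2 (ω : ℝ → ℝ) : Submodule ℂ (Lp ℂ 2 (weightMeasure ω)) where
  carrier := {f | ∃ g : ℂ → ℂ, DifferentiableOn ℂ g disc ∧ f =ᵐ[weightMeasure ω] g}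
  zero_mem' := ⟨0, differentiableOn_const (c := (0 : ℂ)), Lp.coeFn_zero _ _ _⟩
  add_mem' := by
    rintro f₁ f₂ ⟨g₁, hg₁, h₁⟩ ⟨g₂, hg₂, h₂⟩
    exact ⟨g₁ + g₂, hg₁.add hg₂, (Lp.coeFn_add f₁ f₂).trans (h₁.add h₂)⟩
  smul_mem' := by
    rintro c f ⟨g, hg, h⟩
    exact ⟨c • g, hg.const_smul c, (Lp.coeFn_smul c f).trans (h.const_smul c)⟩

/-- The analytic function in the unit disc which represents an element of `A²_ω`. (For a weight
with positive tail integrals it is unique on the disc; only its values there matter.) -/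
def A2.toFun {ω : ℝ → ℝ} (f : A2 ω) : ℂ → ℂ := Classical.choose f.2

/-- `B` is the reproducing kernel of `A²_ω` at `z`: `f(z) = ⟨f, B⟩` for all `f ∈ A²_ω`. -/
def IsKernel (ω : ℝ → ℝ) (z : ℂ) (B : A2 ω) : Prop :=
  ∀ f : A2 ω, A2.toFun f z = inner ℂ B f

open Classical in
/-- The reproducing kernel `B_z` of `A²_ω` at a point `z` of the unit disc. (A vector with the
reproducing property is unique; the value `0` is used only where there is none.) -/
def kernel (ω : ℝ → ℝ) (z : ℂ) : A2 ω :=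
  if h : ∃ B : A2 ω, IsKernel ω z B then h.choose else 0

/-- The normalized reproducing kernel `b_z = B_z / ‖B_z‖`. -/
def normalizedKernel (ω : ℝ → ℝ) (z : ℂ) : A2 ω := ((‖kernel ω z‖ : ℂ)⁻¹) • kernel ω z

/-- The Berezin transform `z ↦ ⟨T b_z, b_z⟩` of a bounded operator on `A²_ω`. -/
def berezin {ω : ℝ → ℝ} (T : A2 ω →L[ℂ] A2 ω) (z : ℂ) : ℂ :=
  inner ℂ (normalizedKernel ω z) (T (normalizedKernel ω z))

/-! ### The trace class -/

section Trace

variable {H : Type} [NormedAddCommGroup H] [InnerProductSpace ℂ H]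

/-- The `n`-th singular value `inf {‖T - R‖ : rank R ≤ n}` of a bounded operator. -/
def singularValue (T : H →L[ℂ] H) (n : ℕ) : ℝ :=
  sInf {t : ℝ | ∃ R : H →L[ℂ] H, LinearMap.rank (R : H →ₗ[ℂ] H) ≤ (n : Cardinal) ∧ t = ‖T - R‖}

/-- The Schatten class `S₁(H)`: the compact operators with summable singular values. -/
def IsTraceClass (T : H →L[ℂ] H) : Prop :=
  IsCompactOperator T ∧ Summable (singularValue T)

/-- The (complex) trace of `T` is `t`: `∑ ⟨T e_i, e_i⟩ = t` in every orthonormal basis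
(and there is an orthonormal basis). -/
def HasTrace (T : H →L[ℂ] H) (t : ℂ) : Prop :=
  (∃ ι : Type, Nonempty (HilbertBasis ι ℂ H)) ∧
    ∀ (ι : Type) (e : HilbertBasis ι ℂ H), HasSum (fun i => inner ℂ (e i) (T (e i))) t

/-- The trace in `[0, ∞]` of a positive operator `T` is `t`: `∑ ⟨T e_i, e_i⟩ = t` in every
orthonormal basis (and there is an orthonormal basis). -/
def HasExtendedTrace (T : H →L[ℂ] H) (t : ℝ≥0∞) : Prop :=
  (∃ ι : Type, Nonempty (HilbertBasis ι ℂ H)) ∧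
    ∀ (ι : Type) (e : HilbertBasis ι ℂ H),
      ∑' i, ENNReal.ofReal (inner ℂ (e i) (T (e i))).re = t

end Trace

end Bergman

end

/-! Write the positive operator as `T = S²` with `S` symmetric. For an orthonormal basis `e_i`, `⟨T
e_i, e_i⟩ = ‖S e_i‖² = ∫ |S e_i|² ω dA`. Parseval and the reproducing property give `∑ |(S e_i)(z)|²
= ‖S B_z‖²`, which is the Berezin transform times `‖B_z‖²`. Exchanging sum and integral yields the
trace formula in `[0, ∞]`, `IsDoubling.tsum_inner_eq_lintegral`. Finiteness of this trace
characterizes the trace class (`isTraceClass_iff_tsum_ne_top`): in one direction eigenvalues of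
compressions are bounded by singular values, in the other `T` is approximated in norm by its
compressions to spans of finitely many `e_i`.

The comparison rests on `‖B_z‖² ω⋆(z) ≍ 1` for `|z| ≥ 1/2`. Since `‖B_z‖²` is the best constant in
`|f(z)|² ≤ K ‖f‖²`, the upper bound comes from a Poisson kernel estimate averaged over the circles
of radius above `(1 + |z|)/2` (`IsRadialWeight.enorm_sq_le`). The lower bound comes from the test
function `w ^ N / (1 - conj z * w)` with `N` about `1/(1 - |z|)`, whose norm is controlled by
moments of `ω`; doubling bounds these by the tail (`IsDoubling.exists_moment_le`). Both sides match
because `ω⋆(z)` is comparable to `(1 - |z|)` times the tail.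

Near the origin only the lower bound survives, because `ω⋆` has a logarithmic singularity there
while `‖B_z‖` stays bounded. The mass of each `|S e_i|²` in `|z| ≤ 1/2` is therefore first absorbed
into its mass in `|z| > 1/2` (`IsDoubling.exists_lintegral_compl_le`). -/

namespace Bergman

/-! ### Singular values and eigenvalues of finite-dimensional operators -/

section Schatten

open Module

variable {H : Type} [NormedAddCommGroup H] [InnerProductSpace ℂ H]
variable {E : Type} [NormedAddCommGroup E] [InnerProductSpace ℂ E]

theorem singularValue_bddBelow (T : H →L[ℂ] H) (n : ℕ) :
    BddBelow {t : ℝ | ∃ R : H →L[ℂ] H,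
      LinearMap.rank (R : H →ₗ[ℂ] H) ≤ (n : Cardinal) ∧ t = ‖T - R‖} :=
  ⟨0, by rintro _ ⟨R, -, rfl⟩; exact norm_nonneg _⟩

theorem singularValue_set_nonempty (T : H →L[ℂ] H) (n : ℕ) :
    {t : ℝ | ∃ R : H →L[ℂ] H,
      LinearMap.rank (R : H →ₗ[ℂ] H) ≤ (n : Cardinal) ∧ t = ‖T - R‖}.Nonempty :=
  ⟨‖T - 0‖, 0, by simp, rfl⟩

theorem singularValue_le (T R : H →L[ℂ] H) {n : ℕ}
    (hR : LinearMap.rank (R : H →ₗ[ℂ] H) ≤ (n : Cardinal)) : singularValue T n ≤ ‖T - R‖ :=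
  csInf_le (singularValue_bddBelow T n) ⟨R, hR, rfl⟩

theorem le_singularValue (T : H →L[ℂ] H) {n : ℕ} {c : ℝ}
    (h : ∀ R : H →L[ℂ] H, LinearMap.rank (R : H →ₗ[ℂ] H) ≤ (n : Cardinal) → c ≤ ‖T - R‖) :
    c ≤ singularValue T n :=
  le_csInf (singularValue_set_nonempty T n) (by rintro _ ⟨R, hR, rfl⟩; exact h R hR)

theorem singularValue_nonneg (T : H →L[ℂ] H) (n : ℕ) : 0 ≤ singularValue T n :=
  le_singularValue T fun _ _ => norm_nonneg _

theorem singularValue_le_add (T T' : H →L[ℂ] H) (n : ℕ) :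
    singularValue T n ≤ singularValue T' n + ‖T - T'‖ := by
  rw [← sub_le_iff_le_add]
  refine le_singularValue T' fun R hR => ?_
  have h1 := singularValue_le T R hR
  have h2 : ‖T - R‖ ≤ ‖T - T'‖ + ‖T' - R‖ := norm_sub_le_norm_sub_add_norm_sub _ _ _
  linarith

/-- An operator of rank at most `k` has a nonzero kernel vector in the image of any injective map
from a space of dimension greater than `k`. -/
theorem exists_ne_zero_apply_eq_zero (R : H →ₗ[ℂ] H) {k : ℕ}
    (hR : LinearMap.rank R ≤ (k : Cardinal)) (L : (Fin (k + 1) → ℂ) →ₗ[ℂ] H) :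
    ∃ c, c ≠ 0 ∧ R (L c) = 0 := by
  by_contra! h
  have hinj : Function.Injective (R ∘ₗ L) := by
    rw [← LinearMap.ker_eq_bot, LinearMap.ker_eq_bot']
    intro m hm
    by_contra hne
    exact h m hne hm
  have h1 : LinearMap.rank (R ∘ₗ L) = ((k + 1 : ℕ) : Cardinal) := by
    rw [LinearMap.rank, rank_range_of_injective _ hinj]
    simp
  have h2 := (LinearMap.rank_comp_le_left L R).trans hR
  rw [h1] at h2
  have := Nat.cast_le.1 h2
  omega

variable [FiniteDimensional ℂ E]

theorem inner_self_eq_sum_eigenvalues {A : E →ₗ[ℂ] E} (hA : A.IsSymmetric) {N : ℕ}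
    (hN : finrank ℂ E = N) (x : E) :
    (inner ℂ x (A x)).re =
      ∑ i, hA.eigenvalues hN i * ‖inner ℂ (hA.eigenvectorBasis hN i) x‖ ^ 2 := by
  rw [← (hA.eigenvectorBasis hN).sum_inner_mul_inner x (A x), Complex.re_sum]
  refine Finset.sum_congr rfl fun i _ => ?_
  rw [← hA, hA.apply_eigenvectorBasis hN i, inner_smul_left]
  rw [← inner_conj_symm x]
  have := Complex.conj_mul' (inner ℂ (hA.eigenvectorBasis hN i) x)
  simp only [RCLike.ofReal_eq_complex_ofReal, Complex.conj_ofReal] at *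
  rw [mul_left_comm, this]
  norm_cast

/-- The eigenvalues of a compression are at most the singular values of the operator. -/
theorem eigenvalues_le_singularValue {T : H →L[ℂ] H} (J : E →ₗᵢ[ℂ] H) {A : E →ₗ[ℂ] E}
    (hA : A.IsSymmetric) (hJ : ∀ x, inner ℂ x (A x) = inner ℂ (J x) (T (J x)))
    {N : ℕ} (hN : finrank ℂ E = N) (k : Fin N) :
    hA.eigenvalues hN k ≤ singularValue T k := by
  refine le_singularValue T fun R hR => ?_
  set b := hA.eigenvectorBasis hN
  -- The top `k + 1` eigenvectors span a space too large for an operator of rank at most `k` to be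
  -- injective on it, so some nonzero `x` in the span has `R (J x) = 0`.
  let φ : Fin (k + 1) → Fin N := fun j => ⟨j, by omega⟩
  have hφ : Function.Injective φ := fun i j h => by
    simp only [φ, Fin.mk.injEq] at h; exact Fin.ext h
  let L : (Fin (k + 1) → ℂ) →ₗ[ℂ] E := Fintype.linearCombination ℂ fun j => b (φ j)
  obtain ⟨c, hc, hRc⟩ := exists_ne_zero_apply_eq_zero (R : H →ₗ[ℂ] H) hR (J.toLinearMap ∘ₗ L)
  have hli : Function.Injective L :=
    linearIndependent_iff_injective_fintypeLinearCombination.1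
      (b.orthonormal.linearIndependent.comp φ hφ)
  set x := L c with hx
  have hx0 : x ≠ 0 := fun h => hc (hli (by rw [← hx, h, map_zero]))
  have hxpos : 0 < ‖x‖ := norm_pos_iff.2 hx0
  have hcoef : ∀ i : Fin N, k < i → inner ℂ (b i) x = 0 := by
    intro i hi
    rw [hx, Fintype.linearCombination_apply, inner_sum]
    refine Finset.sum_eq_zero fun j _ => ?_
    rw [inner_smul_right, b.orthonormal.2, mul_zero]
    rintro rfl
    have : (k : ℕ) < (φ j : ℕ) := hi
    have h2 := j.2
    simp only [φ] at this
    omega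
  have h1 : hA.eigenvalues hN k * ‖x‖ ^ 2 ≤ (inner ℂ x (A x)).re := by
    rw [inner_self_eq_sum_eigenvalues hA hN, ← b.sum_sq_norm_inner_right x, Finset.mul_sum]
    refine Finset.sum_le_sum fun i _ => ?_
    rcases le_or_gt i k with hi | hi
    · exact mul_le_mul_of_nonneg_right (hA.eigenvalues_antitone hN hi) (by positivity)
    · rw [show inner ℂ (hA.eigenvectorBasis hN i) x = 0 from hcoef i hi]
      simp
  have h2 : (inner ℂ x (A x)).re ≤ ‖T - R‖ * ‖x‖ ^ 2 := by
    have h3 : T (J x) = (T - R) (J x) := by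
      have : R (J x) = 0 := hRc
      simp [this]
    rw [hJ, h3]
    calc (inner ℂ (J x) ((T - R) (J x))).re ≤ ‖J x‖ * ‖(T - R) (J x)‖ :=
          re_inner_le_norm (𝕜 := ℂ) _ _
      _ ≤ ‖J x‖ * (‖T - R‖ * ‖J x‖) := by gcongr; exact ContinuousLinearMap.le_opNorm _ _
      _ = ‖T - R‖ * ‖x‖ ^ 2 := by rw [J.norm_map]; ring
  exact le_of_mul_le_mul_right (h1.trans h2) (by positivity)

/-- The singular values of a dilation are at most the eigenvalues of the operator. -/
theorem singularValue_dilation_le {A : E →L[ℂ] E} (hA : (A : E →ₗ[ℂ] E).IsPositive)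
    (J : E →L[ℂ] H) (hJ : ‖J‖ ≤ 1) (Q : H →L[ℂ] E) (hQ : ‖Q‖ ≤ 1)
    {N : ℕ} (hN : finrank ℂ E = N) (k : Fin N) :
    singularValue (J ∘L A ∘L Q) k ≤ hA.isSymmetric.eigenvalues hN k := by
  set b := hA.isSymmetric.eigenvectorBasis hN with hb
  set l := hA.isSymmetric.eigenvalues hN with hl
  have hl0 : ∀ i, 0 ≤ l i := hA.nonneg_eigenvalues hN
  -- Spectral truncation: `A'` keeps the `k` largest eigenvalues, so it has rank at most `k`, and
  -- the largest eigenvalue of `A - A'` is `l k`.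
  let A' : E →L[ℂ] E := ∑ j : Fin k, (l ⟨j, by omega⟩ : ℂ) •
    (innerSL ℂ (b ⟨j, by omega⟩)).smulRight (b ⟨j, by omega⟩)
  have hA'b : ∀ i, A' (b i) = if i < k then (l i : ℂ) • b i else 0 := by
    intro i
    simp only [A', sum_apply, smul_apply,
      ContinuousLinearMap.smulRight_apply, innerSL_apply_apply,
      orthonormal_iff_ite.1 b.orthonormal]
    split_ifs with h
    · rw [Finset.sum_eq_single ⟨i, h⟩]
      · simp
      · intro j _ hj
        rw [if_neg, zero_smul, smul_zero]
        rintro rfl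
        exact hj rfl
      · simp
    · refine Finset.sum_eq_zero fun j _ => ?_
      rw [if_neg, zero_smul, smul_zero]
      rintro rfl
      exact h j.2
  have hrank : LinearMap.rank ((J ∘L A' ∘L Q : H →L[ℂ] H) : H →ₗ[ℂ] H) ≤ ((k : ℕ) : Cardinal) := by
    let Φ : H →ₗ[ℂ] (Fin k → ℂ) :=
      LinearMap.pi fun j => ((innerSL ℂ (b ⟨j, by omega⟩)) ∘L Q : H →L[ℂ] ℂ).toLinearMap
    let Ψ : (Fin k → ℂ) →ₗ[ℂ] H :=
      Fintype.linearCombination ℂ fun j : Fin k => (l ⟨j, by omega⟩ : ℂ) • J (b ⟨j, by omega⟩)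
    have : ((J ∘L A' ∘L Q : H →L[ℂ] H) : H →ₗ[ℂ] H) = Ψ ∘ₗ Φ := by
      ext x
      simp only [A', Φ, Ψ, Fintype.linearCombination_apply, map_sum,
        LinearMap.comp_apply, ContinuousLinearMap.coe_coe, sum_apply, smul_apply,
        ContinuousLinearMap.smulRight_apply, innerSL_apply_apply, LinearMap.pi_apply, map_smul,
        ContinuousLinearMap.comp_apply]
      exact Finset.sum_congr rfl fun _ _ => smul_comm _ _ _
    rw [this]
    refine (LinearMap.rank_comp_le_left Φ Ψ).trans ?_
    refine (LinearMap.rank_le_domain Ψ).trans ?_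
    simp
  refine (singularValue_le _ _ hrank).trans ?_
  have hdiff : ‖A - A'‖ ≤ l k := by
    refine ContinuousLinearMap.opNorm_le_bound _ (hl0 k) fun x => ?_
    have hcoef : ∀ i, ‖inner ℂ (b i) ((A - A') x)‖ ≤ l k * ‖inner ℂ (b i) x‖ := by
      intro i
      have hAb : ∀ i, A (b i) = (l i : ℂ) • b i := fun i =>
        hA.isSymmetric.apply_eigenvectorBasis hN i
      have hexp : (A - A') x = ∑ j, (if j < k then (0 : ℂ) else l j * inner ℂ (b j) x) • b j := by
        conv_lhs => rw [← b.sum_repr x]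
        rw [map_sum]
        refine Finset.sum_congr rfl fun j _ => ?_
        rw [map_smul, sub_apply, hAb, hA'b, b.repr_apply_apply]
        split_ifs
        · simp
        · rw [sub_zero, smul_smul, mul_comm]
      rw [hexp, inner_sum, Finset.sum_eq_single i]
      · rw [inner_smul_right, orthonormal_iff_ite.1 b.orthonormal, if_pos rfl, mul_one]
        split_ifs with h
        · rw [norm_zero]; exact mul_nonneg (hl0 k) (norm_nonneg _)
        · rw [norm_mul, Complex.norm_real, Real.norm_of_nonneg (hl0 i)]
          exact mul_le_mul_of_nonneg_right
            (hA.isSymmetric.eigenvalues_antitone hN (not_lt.1 h)) (norm_nonneg _)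
      · intro j _ hj
        rw [inner_smul_right, orthonormal_iff_ite.1 b.orthonormal, if_neg hj.symm, mul_zero]
      · simp
    rw [← sq_le_sq₀ (norm_nonneg _) (mul_nonneg (hl0 k) (norm_nonneg _)), mul_pow,
      ← b.sum_sq_norm_inner_right, ← b.sum_sq_norm_inner_right, Finset.mul_sum]
    refine Finset.sum_le_sum fun i _ => ?_
    rw [← mul_pow]
    exact pow_le_pow_left₀ (norm_nonneg _) (hcoef i) 2
  have : J ∘L A ∘L Q - J ∘L A' ∘L Q = J ∘L (A - A') ∘L Q := by
    ext x; simp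
  rw [this]
  calc ‖J ∘L (A - A') ∘L Q‖ ≤ ‖J‖ * (‖A - A'‖ * ‖Q‖) :=
        (ContinuousLinearMap.opNorm_comp_le _ _).trans (by
          gcongr; exact ContinuousLinearMap.opNorm_comp_le _ _)
    _ ≤ 1 * (l k * 1) := by
        have := hl0 k
        gcongr
    _ = l k := by ring

theorem singularValue_dilation_nonpos (A : E →L[ℂ] E)
    (J : E →L[ℂ] H) (Q : H →L[ℂ] E) {k : ℕ} (hk : finrank ℂ E ≤ k) :
    singularValue (J ∘L A ∘L Q) k ≤ 0 := by
  have hrank : LinearMap.rank ((J ∘L A ∘L Q : H →L[ℂ] H) : H →ₗ[ℂ] H) ≤ (k : Cardinal) := by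
    refine (LinearMap.rank_comp_le_left ((A ∘L Q : H →L[ℂ] E) : H →ₗ[ℂ] E)
      (J : E →ₗ[ℂ] H)).trans ?_
    refine (LinearMap.rank_le_domain _).trans ?_
    rw [← finrank_eq_rank ℂ E]
    exact_mod_cast hk
  exact (singularValue_le _ _ hrank).trans (by simp)

/-- Indices below `finrank ℂ E` contribute at most the eigenvalues, whose sum is the trace; for the
others the rank forces the singular value to vanish. Hence the bound is uniform in `M`. -/
theorem sum_singularValue_dilation_le {A : E →L[ℂ] E} (hA : (A : E →ₗ[ℂ] E).IsPositive)
    (J : E →L[ℂ] H) (hJ : ‖J‖ ≤ 1) (Q : H →L[ℂ] E) (hQ : ‖Q‖ ≤ 1) (M : ℕ) :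
    ∑ k ∈ Finset.range M, singularValue (J ∘L A ∘L Q) k ≤
      (LinearMap.trace ℂ E (A : E →ₗ[ℂ] E)).re := by
  have htr := hA.isSymmetric.re_trace_eq_sum_eigenvalues (rfl : finrank ℂ E = finrank ℂ E)
  rw [RCLike.re_eq_complex_re] at htr
  rw [htr]
  calc ∑ k ∈ Finset.range M, singularValue (J ∘L A ∘L Q) k
      ≤ ∑ k ∈ Finset.range (finrank ℂ E), singularValue (J ∘L A ∘L Q) k := by
        rcases le_total M (finrank ℂ E) with h | h
        · exact Finset.sum_le_sum_of_subset_of_nonneg (Finset.range_mono h)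
            fun _ _ _ => singularValue_nonneg _ _
        · rw [← Finset.sum_sdiff (Finset.range_mono h)]
          have : ∑ k ∈ Finset.range M \ Finset.range (finrank ℂ E),
              singularValue (J ∘L A ∘L Q) k ≤ 0 :=
            Finset.sum_nonpos fun k hk => singularValue_dilation_nonpos A J Q (by
              simp only [Finset.mem_sdiff, Finset.mem_range, not_lt] at hk; exact hk.2)
          linarith
    _ = ∑ k : Fin (finrank ℂ E), singularValue (J ∘L A ∘L Q) k := (Fin.sum_univ_eq_sum_range _ _).symm
    _ ≤ _ := Finset.sum_le_sum fun k _ => singularValue_dilation_le hA J hJ Q hQ rfl k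

end Schatten

/-! ### Trace class and finite trace for positive operators -/

section TraceClass

open Module Filter Topology

variable {H : Type} [NormedAddCommGroup H] [InnerProductSpace ℂ H] [CompleteSpace H]

/-- A positive operator has a symmetric square root. -/
theorem exists_sqrt {T : H →L[ℂ] H} (hT : T.IsPositive) :
    ∃ S : H →L[ℂ] H, (∀ x y, inner ℂ (S x) y = inner ℂ x (S y)) ∧ ∀ x, S (S x) = T x := by
  have h0 : 0 ≤ T := (ContinuousLinearMap.nonneg_iff_isPositive T).2 hT
  have hS : (CFC.sqrt T).IsPositive :=
    (ContinuousLinearMap.nonneg_iff_isPositive _).1 (CFC.sqrt_nonneg T)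
  refine ⟨CFC.sqrt T, fun x y => hS.isSymmetric x y, fun x => ?_⟩
  conv_rhs => rw [← CFC.sqrt_mul_sqrt_self T h0]
  rfl

/-- The compression of an operator to a finite-dimensional subspace. -/
noncomputable def compression (T : H →L[ℂ] H) (V : Submodule ℂ H) [FiniteDimensional ℂ V] :
    V →L[ℂ] V :=
  V.orthogonalProjectionOnto ∘L T ∘L V.subtypeL

omit [CompleteSpace H] in
theorem inner_compression (T : H →L[ℂ] H) (V : Submodule ℂ H) [FiniteDimensional ℂ V] (x y : V) :
    inner ℂ x (compression T V y) = inner ℂ (x : H) (T y) := by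
  exact V.inner_orthogonalProjectionOnto_eq_of_mem_left x (T y)

theorem compression_isPositive {T : H →L[ℂ] H} (hT : T.IsPositive) (V : Submodule ℂ H)
    [FiniteDimensional ℂ V] : ((compression T V : V →L[ℂ] V) : V →ₗ[ℂ] V).IsPositive := by
  have := hT.adjoint_conj V.subtypeL
  rw [V.adjoint_subtypeL] at this
  exact this.toLinearMap

open Classical in
omit [CompleteSpace H] in
theorem trace_compression {ι : Type} {e : ι → H} (he : Orthonormal ℂ e) (T : H →L[ℂ] H)
    (F : Finset ι) :
    (LinearMap.trace ℂ _ (compression T (Submodule.span ℂ (F.image e : Set H)) :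
      _ →ₗ[ℂ] (Submodule.span ℂ (F.image e : Set H)))).re =
      ∑ i ∈ F, (inner ℂ (e i) (T (e i))).re := by
  rw [LinearMap.trace_eq_sum_inner _ (OrthonormalBasis.span he F), Complex.re_sum,
    ← Finset.sum_coe_sort F]
  refine Finset.sum_congr rfl fun i _ => ?_
  rw [ContinuousLinearMap.coe_coe, inner_compression, OrthonormalBasis.span_apply]

omit [CompleteSpace H] in
theorem re_inner_eq_norm_sq {T S : H →L[ℂ] H} (hS : ∀ x y, inner ℂ (S x) y = inner ℂ x (S y))
    (hST : ∀ x, S (S x) = T x) (x : H) : inner ℂ x (T x) = ((‖S x‖ ^ 2 : ℝ) : ℂ) := by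
  rw [← hST, ← hS, inner_self_eq_norm_sq_to_K]
  norm_cast

/-- The trace of a compression is bounded by the sum of the singular values. -/
theorem sum_inner_le_tsum_singularValue {T : H →L[ℂ] H} (hT : T.IsPositive)
    (hs : Summable (singularValue T)) {ι : Type} {e : ι → H} (he : Orthonormal ℂ e)
    (F : Finset ι) : ∑ i ∈ F, (inner ℂ (e i) (T (e i))).re ≤ ∑' n, singularValue T n := by
  classical
  rw [← trace_compression he T F]
  set V := Submodule.span ℂ (F.image e : Set H)
  have hA := compression_isPositive hT V
  have htr := hA.isSymmetric.re_trace_eq_sum_eigenvalues (rfl : finrank ℂ V = finrank ℂ V)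
  rw [RCLike.re_eq_complex_re] at htr
  rw [htr]
  calc ∑ i : Fin (finrank ℂ V), hA.isSymmetric.eigenvalues rfl i
      ≤ ∑ i : Fin (finrank ℂ V), singularValue T i := Finset.sum_le_sum fun k _ =>
        eigenvalues_le_singularValue V.subtypeₗᵢ hA.isSymmetric
          (fun x => inner_compression T V x x) rfl k
    _ = ∑ i ∈ Finset.range (finrank ℂ V), singularValue T i := Fin.sum_univ_eq_sum_range _ _
    _ ≤ _ := hs.sum_le_tsum _ fun _ _ => singularValue_nonneg _ _

/-- Compressions of a positive operator with finite trace converge to it in norm. -/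
theorem exists_norm_sub_dilation_le {T : H →L[ℂ] H} (hT : T.IsPositive) {ι : Type}
    (e : HilbertBasis ι ℂ H) (hs : Summable fun i => (inner ℂ (e i) (T (e i))).re)
    {ε : ℝ} (hε : 0 < ε) : ∃ V : Submodule ℂ H, ∃ _ : FiniteDimensional ℂ V,
      ‖T - V.subtypeL ∘L compression T V ∘L V.orthogonalProjectionOnto‖ ≤ ε ∧
      (LinearMap.trace ℂ V (compression T V : V →ₗ[ℂ] V)).re ≤
        ∑' i, (inner ℂ (e i) (T (e i))).re := by
  classical
  obtain ⟨S, hS, hST⟩ := exists_sqrt hT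
  have hre : ∀ i, (inner ℂ (e i) (T (e i))).re = ‖S (e i)‖ ^ 2 := fun i => by
    rw [re_inner_eq_norm_sq hS hST, Complex.ofReal_re]
  have hs' : Summable fun i => ‖S (e i)‖ ^ 2 := by simpa only [hre] using hs
  -- The final error is `2 ‖S‖ δ`; the `+ 1` covers `S = 0`.
  set δ := ε / (2 * (‖S‖ + 1)) with hδ
  have hδ0 : 0 < δ := by positivity
  obtain ⟨F, hF⟩ := summable_iff_vanishing_norm.1 hs' (δ ^ 2) (by positivity)
  refine ⟨Submodule.span ℂ (F.image e : Set H), inferInstance, ?_, ?_⟩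
  swap
  · rw [trace_compression e.orthonormal]
    exact hs.sum_le_tsum _ fun i _ => by rw [hre]; positivity
  set V := Submodule.span ℂ (F.image e : Set H) with hV
  set P : H →L[ℂ] H := V.starProjection with hP
  have hPeq : V.subtypeL ∘L compression T V ∘L V.orthogonalProjectionOnto = P ∘L T ∘L P := rfl
  have hPn : ‖P‖ ≤ 1 := V.starProjection_norm_le
  -- `S` is Hilbert–Schmidt and `(1 - P) x` has no coefficients in `F`, so Cauchy–Schwarz leaves
  -- only `∑ ‖S e_i‖²` over indices off `F`, which is below `δ²`.
  have hSP : ‖S ∘L (1 - P)‖ ≤ δ := by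
    refine ContinuousLinearMap.opNorm_le_bound _ hδ0.le fun x => ?_
    set z := (1 - P) x with hz
    have hz' : z = x - V.starProjection x := rfl
    have hzn : ‖z‖ ≤ ‖x‖ := by
      rw [hz', ← V.starProjection_orthogonal_val]
      exact Vᗮ.norm_starProjection_apply_le x
    have hz0 : ∀ i ∈ F, inner ℂ (e i) z = 0 := fun i hi =>
      V.sub_starProjection_mem_orthogonal x _
        (Submodule.subset_span (by simpa using ⟨i, hi, rfl⟩))
    have hsum : HasSum (fun i => inner ℂ (e i) z • S (e i)) (S z) := by
      have := (e.hasSum_repr z).mapL S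
      simpa only [map_smul, e.repr_apply_apply] using this
    have hb : ∀ G : Finset ι, ‖∑ i ∈ G, inner ℂ (e i) z • S (e i)‖ ≤ δ * ‖x‖ := by
      intro G
      have h1 : ∑ i ∈ G, inner ℂ (e i) z • S (e i) =
          ∑ i ∈ G \ F, inner ℂ (e i) z • S (e i) := by
        refine (Finset.sum_subset Finset.sdiff_subset fun i hi hi' => ?_).symm
        rw [hz0 i (by simpa [hi] using hi'), zero_smul]
      rw [h1, ← sq_le_sq₀ (norm_nonneg _) (by positivity)]
      calc ‖∑ i ∈ G \ F, inner ℂ (e i) z • S (e i)‖ ^ 2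
          ≤ (∑ i ∈ G \ F, ‖inner ℂ (e i) z‖ * ‖S (e i)‖) ^ 2 := by
            gcongr
            refine (norm_sum_le _ _).trans (le_of_eq ?_)
            simp only [norm_smul]
        _ ≤ (∑ i ∈ G \ F, ‖inner ℂ (e i) z‖ ^ 2) * ∑ i ∈ G \ F, ‖S (e i)‖ ^ 2 :=
            Finset.sum_mul_sq_le_sq_mul_sq _ _ _
        _ ≤ ‖x‖ ^ 2 * δ ^ 2 := by
            gcongr
            · exact (e.orthonormal.sum_inner_products_le z).trans (by gcongr)
            · exact (le_abs_self _).trans (hF (G \ F) Finset.sdiff_disjoint).le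
        _ = (δ * ‖x‖) ^ 2 := by ring
    exact le_of_tendsto hsum.norm (Eventually.of_forall hb)
  have hTP : ‖T ∘L (1 - P)‖ ≤ ‖S‖ * δ := by
    have : T ∘L (1 - P) = S ∘L (S ∘L (1 - P)) := by
      ext x; exact (hST _).symm
    rw [this]
    exact (ContinuousLinearMap.opNorm_comp_le _ _).trans (by gcongr)
  -- This is the adjoint of `T ∘L (1 - P)`, since `T` and `P` are self-adjoint.
  have hPT : ‖(1 - P) ∘L T‖ ≤ ‖S‖ * δ := by
    rw [← ContinuousLinearMap.adjoint.norm_map, ContinuousLinearMap.adjoint_comp,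
      hT.isSelfAdjoint.adjoint_eq, map_sub, hP, V.starProjection_isSymmetric.isSelfAdjoint.adjoint_eq]
    have : ContinuousLinearMap.adjoint (1 : H →L[ℂ] H) = 1 := ContinuousLinearMap.adjoint_id
    rwa [this]
  have hdec : T - P ∘L T ∘L P = (1 - P) ∘L T + P ∘L (T ∘L (1 - P)) := by
    ext x; simp
  rw [hPeq, hdec]
  calc _ ≤ ‖(1 - P) ∘L T‖ + ‖P‖ * ‖T ∘L (1 - P)‖ :=
        (norm_add_le _ _).trans (by gcongr; exact ContinuousLinearMap.opNorm_comp_le _ _)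
    _ ≤ ‖S‖ * δ + 1 * (‖S‖ * δ) := by gcongr
    _ = (2 * ‖S‖) * δ := by ring
    _ ≤ (2 * (‖S‖ + 1)) * δ := by gcongr; linarith
    _ = ε := by rw [hδ]; field_simp

/-- A positive operator is of trace class if and only if its trace is finite. -/
theorem isTraceClass_iff_tsum_ne_top {T : H →L[ℂ] H} (hT : T.IsPositive) {ι : Type}
    (e : HilbertBasis ι ℂ H) :
    IsTraceClass T ↔ ∑' i, ENNReal.ofReal (inner ℂ (e i) (T (e i))).re ≠ ∞ := by
  have h0 : ∀ i, 0 ≤ (inner ℂ (e i) (T (e i))).re := fun i => hT.re_inner_nonneg_right (e i)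
  constructor
  · rintro ⟨-, hs⟩
    have hsum : Summable fun i => (inner ℂ (e i) (T (e i))).re :=
      summable_of_sum_le h0 fun F => sum_inner_le_tsum_singularValue hT hs e.orthonormal F
    rw [← ENNReal.ofReal_tsum_of_nonneg h0 hsum]
    exact ENNReal.ofReal_ne_top
  · intro h
    have hs : Summable fun i => (inner ℂ (e i) (T (e i))).re := by
      have := ENNReal.summable_toReal h
      simpa only [ENNReal.toReal_ofReal (h0 _)] using this
    constructor
    · have hcl := isClosed_setOfPred_isCompactOperator (M₁ := H) (M₂ := H) (σ₁₂ := RingHom.id ℂ)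
      refine hcl.closure_subset (Metric.mem_closure_iff.2 fun ε hε => ?_)
      obtain ⟨V, hV, h1, -⟩ := exists_norm_sub_dilation_le hT e hs (half_pos hε)
      refine ⟨V.subtypeL ∘L compression T V ∘L V.orthogonalProjectionOnto, ?_, ?_⟩
      · have : IsCompactOperator (V.subtypeL : V →L[ℂ] H) :=
          have : ProperSpace V := FiniteDimensional.proper ℂ V
          isCompactOperator_of_locallyCompactSpace_rng V.subtypeL
        exact this.comp_clm (compression T V ∘L V.orthogonalProjectionOnto)
      · rw [dist_eq_norm]; linarith
    · refine summable_of_sum_range_le (c := ∑' i, (inner ℂ (e i) (T (e i))).re)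
        (singularValue_nonneg T) fun M => ?_
      refine le_of_forall_pos_le_add fun ε hε => ?_
      -- Each singular value moves by at most the norm error, so `M` of them move by at most `M * (ε
      -- / (M + 1)) ≤ ε` in total; the trace bound depends on neither `M` nor `ε`.
      obtain ⟨V, hV, h1, h2⟩ := exists_norm_sub_dilation_le hT e hs
        (ε := ε / (M + 1)) (by positivity)
      have h3 := sum_singularValue_dilation_le (compression_isPositive hT V) V.subtypeL
        V.norm_subtypeL_le V.orthogonalProjectionOnto V.orthogonalProjectionOnto_norm_le M
      have h4 : (M : ℝ) * (ε / (M + 1)) ≤ ε := by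
        rw [mul_div_assoc', div_le_iff₀ (by positivity)]
        nlinarith
      calc ∑ k ∈ Finset.range M, singularValue T k
          ≤ ∑ k ∈ Finset.range M, (singularValue
            (V.subtypeL ∘L compression T V ∘L V.orthogonalProjectionOnto) k + ε / (M + 1)) :=
            Finset.sum_le_sum fun k _ => (singularValue_le_add T _ k).trans (by gcongr)
        _ = ∑ k ∈ Finset.range M, singularValue
            (V.subtypeL ∘L compression T V ∘L V.orthogonalProjectionOnto) k +
            M * (ε / (M + 1)) := by
            rw [Finset.sum_add_distrib, Finset.sum_const, Finset.card_range, nsmul_eq_mul]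
        _ ≤ _ := by linarith

end TraceClass

/-! ### Poisson kernel estimates on circles -/

section Circle

open Real Set

theorem differentiableOn_closedBall_of_disc {f : ℂ → ℂ} (hf : DifferentiableOn ℂ f disc) {s : ℝ}
    (hs1 : s < 1) : DifferentiableOn ℂ f (Metric.closedBall 0 s) :=
  hf.mono (Metric.closedBall_subset_ball hs1)

theorem diffContOnCl_ball_of_disc {f : ℂ → ℂ} (hf : DifferentiableOn ℂ f disc) {s : ℝ}
    (hs1 : s < 1) : DiffContOnCl ℂ f (Metric.ball 0 s) :=
  ((differentiableOn_closedBall_of_disc hf hs1).mono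
    Metric.closure_ball_subset_closedBall).diffContOnCl

theorem continuousOn_sphere_of_disc {f : ℂ → ℂ} (hf : DifferentiableOn ℂ f disc) {s : ℝ}
    (hs0 : 0 < s) (hs1 : s < 1) : ContinuousOn f (Metric.sphere 0 |s|) := by
  rw [abs_of_pos hs0]
  exact (differentiableOn_closedBall_of_disc hf hs1).continuousOn.mono
    Metric.sphere_subset_closedBall

theorem continuousOn_poissonKernel {a : ℂ} {s : ℝ} (hs0 : 0 < s) (ha : ‖a‖ < s) :
    ContinuousOn (poissonKernel 0 a) (Metric.sphere 0 |s|) := by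
  unfold poissonKernel
  refine ContinuousOn.div (by fun_prop) (by fun_prop) fun x hx => ?_
  rw [abs_of_pos hs0, mem_sphere_zero_iff_norm] at hx
  have : x ≠ a := by rintro rfl; linarith
  simpa [sub_eq_zero] using this

/-- Sub-mean value property of `|f|²` with the Poisson kernel estimated by its maximum. -/
theorem norm_sq_le_circleAverage {f : ℂ → ℂ} (hf : DifferentiableOn ℂ f disc) {s : ℝ}
    (hs0 : 0 < s) (hs1 : s < 1) {z : ℂ} (hz : ‖z‖ < s) :
    (s - ‖z‖) / (s + ‖z‖) * ‖f z‖ ^ 2 ≤ circleAverage (fun w => ‖f w‖ ^ 2) 0 s := by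
  have hzb : z ∈ Metric.ball (0 : ℂ) s := by simpa using hz
  -- The Poisson formula is applied to the analytic function `f²`; taking norms gives the inequality
  -- for `|f|²`.
  have hf2 : DifferentiableOn ℂ (fun w => f w ^ 2) disc := hf.pow 2
  have hP := (diffContOnCl_ball_of_disc hf2 hs1).circleAverage_poissonKernel_smul hzb
  have hc := continuousOn_sphere_of_disc hf hs0 hs1
  have hcP := continuousOn_poissonKernel hs0 hz
  have hP0 : ∀ w ∈ Metric.sphere (0 : ℂ) |s|,
      0 ≤ poissonKernel 0 z w ∧ poissonKernel 0 z w ≤ (s + ‖z‖) / (s - ‖z‖) := by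
    intro w hw
    rw [abs_of_pos hs0] at hw
    constructor
    · rw [mem_sphere_zero_iff_norm] at hw
      rw [poissonKernel_def, sub_zero, sub_zero, hw]
      have := norm_nonneg z
      exact div_nonneg (by nlinarith) (by positivity)
    · rw [poissonKernel_eq_re_herglotzRieszKernel]
      simpa [herglotzRieszKernel_def] using re_herglotzRieszKernel_le hw hzb
  have h1 : ‖f z‖ ^ 2 ≤ circleAverage (fun w => poissonKernel 0 z w * ‖f w‖ ^ 2) 0 s := by
    rw [← norm_pow, ← hP, circleAverage_def, circleAverage_def, norm_smul, smul_eq_mul,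
      norm_of_nonneg (by positivity)]
    gcongr
    refine (intervalIntegral.norm_integral_le_integral_norm two_pi_pos.le).trans (le_of_eq ?_)
    refine intervalIntegral.integral_congr fun θ _ => ?_
    have := (hP0 _ (circleMap_mem_sphere' 0 s θ)).1
    simp [abs_of_nonneg this]
  have h2 : circleAverage (fun w => poissonKernel 0 z w * ‖f w‖ ^ 2) 0 s ≤
      circleAverage (((s + ‖z‖) / (s - ‖z‖)) • fun w => ‖f w‖ ^ 2) 0 s := by
    refine circleAverage_mono ?_ ?_ fun w hw => ?_
    · exact (hcP.mul (hc.norm.pow 2)).circleIntegrable'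
    · exact ((hc.norm.pow 2).const_smul _).circleIntegrable'
    · exact mul_le_mul_of_nonneg_right (hP0 w hw).2 (by positivity)
  rw [circleAverage_smul, smul_eq_mul] at h2
  have h3 : 0 < s - ‖z‖ := by linarith
  have h4 : 0 < s + ‖z‖ := by positivity
  rw [div_mul_eq_mul_div, div_le_iff₀ h4]
  have := h1.trans h2
  rw [div_mul_eq_mul_div, le_div_iff₀ h3] at this
  linarith

/-- On `|w| = s` one has `|w - s² z| = s |1 - conj z * w|`, so the integrand is a multiple of the
Poisson kernel at `a = s² z`, whose average is `1`. -/
theorem circleAverage_szego {s : ℝ} (hs0 : 0 < s) (hs1 : s < 1) {z : ℂ} (hz : ‖z‖ < 1) :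
    circleAverage (fun w => (‖1 - (starRingEnd ℂ) z * w‖ ^ 2)⁻¹) 0 s =
      (1 - s ^ 2 * ‖z‖ ^ 2)⁻¹ := by
  set a : ℂ := (s ^ 2 : ℝ) * z with ha
  have han : ‖a‖ = s ^ 2 * ‖z‖ := by
    rw [ha, norm_mul, Complex.norm_real, norm_of_nonneg (by positivity)]
  have hzn := norm_nonneg z
  have has : ‖a‖ < s := by rw [han]; nlinarith
  have hpos : 0 < 1 - s ^ 2 * ‖z‖ ^ 2 := by
    have h1 : s * ‖z‖ < 1 := by nlinarith
    have h0 : 0 ≤ s * ‖z‖ := by positivity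
    nlinarith
  have hP := (diffContOnCl_const (c := (1 : ℂ)) (s := Metric.ball 0 s)
    |>.circleAverage_poissonKernel_smul (show a ∈ Metric.ball (0 : ℂ) s by simpa using has))
  have hP' : circleAverage (poissonKernel 0 a) 0 s = 1 := by
    have hci : CircleIntegrable (poissonKernel 0 a) 0 s :=
      (continuousOn_poissonKernel hs0 has).circleIntegrable'
    have := Complex.ofRealCLM.circleAverage_comp_comm hci
    have h2 : (poissonKernel 0 a • fun _ => (1 : ℂ)) = Complex.ofRealCLM ∘ poissonKernel 0 a := by
      ext w; simp
    rw [h2, this] at hP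
    exact Complex.ofReal_injective hP
  refine eq_inv_of_mul_eq_one_left ?_
  refine Eq.trans ?_ hP'
  rw [mul_comm, ← smul_eq_mul, ← circleAverage_smul]
  refine circleAverage_congr_sphere fun w hw => ?_
  rw [abs_of_pos hs0, mem_sphere_zero_iff_norm] at hw
  have hkey : ‖w - a‖ = s * ‖1 - (starRingEnd ℂ) z * w‖ := by
    have h1 : (starRingEnd ℂ) w * (w - a) =
        ((s ^ 2 : ℝ) : ℂ) * (starRingEnd ℂ) (1 - (starRingEnd ℂ) z * w) := by
      have : (starRingEnd ℂ) w * w = ((s ^ 2 : ℝ) : ℂ) := by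
        rw [Complex.conj_mul', hw]; push_cast; rfl
      rw [mul_sub, this, ha, map_sub, map_one, map_mul, Complex.conj_conj]
      ring
    have h2 := congrArg norm h1
    rw [norm_mul, norm_mul, RCLike.norm_conj, RCLike.norm_conj, hw, Complex.norm_real,
      norm_of_nonneg (by positivity)] at h2
    have h3 : s * ‖w - a‖ = s * (s * ‖1 - (starRingEnd ℂ) z * w‖) := by rw [h2]; ring
    exact mul_left_cancel₀ hs0.ne' h3
  have hne : ‖1 - (starRingEnd ℂ) z * w‖ ≠ 0 := by
    intro h0
    rw [h0, mul_zero, norm_eq_zero, sub_eq_zero] at hkey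
    rw [← hkey, hw] at has
    exact lt_irrefl _ has
  simp only [Pi.smul_apply, smul_eq_mul, poissonKernel_def, sub_zero, hkey, hw, han]
  field_simp

/-- The integral over a centred circle, in the parametrization of polar coordinates. -/
theorem lintegral_circle {u : ℂ → ℝ} {s : ℝ} (hu : ContinuousOn u (Metric.sphere 0 |s|))
    (hu0 : ∀ w ∈ Metric.sphere (0 : ℂ) |s|, 0 ≤ u w) :
    ∫⁻ θ in Ioo (-π) π, ENNReal.ofReal (u (Complex.polarCoord.symm (s, θ))) =
      ENNReal.ofReal (2 * π * circleAverage u 0 s) := by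
  have hpc : ∀ θ, Complex.polarCoord.symm (s, θ) = circleMap 0 s θ := fun θ => by
    simp [circleMap, Complex.exp_mul_I]
  have hcont : Continuous fun θ => u (circleMap 0 s θ) :=
    hu.comp_continuous (continuous_circleMap 0 s) fun θ => circleMap_mem_sphere' 0 s θ
  simp only [hpc]
  rw [← ofReal_integral_eq_lintegral_ofReal]
  · congr 1
    rw [circleAverage_def, smul_eq_mul, mul_inv_cancel_left₀ (by positivity),
      ← integral_Ioc_eq_integral_Ioo, ← intervalIntegral.integral_of_le (by linarith [pi_pos])]
    have hper : Function.Periodic (fun θ => u (circleMap 0 s θ)) (2 * π) := fun θ => by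
      simp only [periodic_circleMap 0 s θ]
    have := hper.intervalIntegral_add_eq (-π) 0
    rw [zero_add] at this
    rw [← this]
    congr 1
    ring
  · exact (hcont.integrableOn_Icc (a := -π) (b := π)).mono_set Ioo_subset_Icc_self
  · exact Filter.Eventually.of_forall fun θ => hu0 _ (circleMap_mem_sphere' 0 s θ)

end Circle

/-! ### Polar coordinates for a radial weight -/

section Polar

open Real Set

variable {ω : ℝ → ℝ}

theorem measurableSet_disc : MeasurableSet disc := measurableSet_ball

theorem IsRadialWeight.integrableOn_mul (hω : IsRadialWeight ω) :
    IntegrableOn (fun s => s * ω s) (Ioo 0 1) := by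
  have := (integrableOn_fun_norm_addHaar (E := ℂ) volume (f := ω) (r := 1)).1 hω.integrable
  simpa [Complex.finrank_real_complex] using this

theorem IsRadialWeight.aemeasurable (hω : IsRadialWeight ω) :
    AEMeasurable ω (volume.restrict (Ioo 0 1)) := by
  have h1 : AEMeasurable (fun s : ℝ => s⁻¹ * (s * ω s)) (volume.restrict (Ioo 0 1)) :=
    measurable_inv.aemeasurable.mul hω.integrableOn_mul.aestronglyMeasurable.aemeasurable
  refine h1.congr ?_
  filter_upwards [ae_restrict_mem measurableSet_Ioo] with s hs
  exact inv_mul_cancel_left₀ hs.1.ne' _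

theorem IsRadialWeight.aemeasurable_norm (hω : IsRadialWeight ω) :
    AEMeasurable (fun z : ℂ => ω ‖z‖) area :=
  (hω.integrable.aestronglyMeasurable.aemeasurable).smul_measure _

/-- Integration against `ω dA` in polar coordinates. -/
theorem lintegral_weightMeasure (hω : IsRadialWeight ω) {g : ℂ → ℝ≥0∞} (hg : Measurable g) :
    ∫⁻ z, g z ∂(weightMeasure ω) = ENNReal.ofReal (1 / π) *
      ∫⁻ s in Ioo 0 1, ENNReal.ofReal (s * ω s) *
        ∫⁻ θ in Ioo (-π) π, g (Complex.polarCoord.symm (s, θ)) := by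
  rw [weightMeasure, lintegral_withDensity_eq_lintegral_mul₀ hω.aemeasurable_norm.ennreal_ofReal
    hg.aemeasurable, area, lintegral_smul_measure, smul_eq_mul, ← lintegral_indicator
    measurableSet_disc, ← Complex.lintegral_comp_polarCoord_symm]
  congr 1
  have hset : Ioo (0 : ℝ) 1 ×ˢ Ioo (-π) π ⊆ polarCoord.target :=
    prod_mono (fun x hx => hx.1) subset_rfl
  rw [← lintegral_inter_add_sdiff _ polarCoord.target
    (measurableSet_Ioo.prod measurableSet_Ioo : MeasurableSet (Ioo (0 : ℝ) 1 ×ˢ Ioo (-π) π)),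
    inter_eq_self_of_subset_right hset]
  have h0 : ∫⁻ p in polarCoord.target \ Ioo (0 : ℝ) 1 ×ˢ Ioo (-π) π,
      ENNReal.ofReal p.1 • disc.indicator ((fun z => ENNReal.ofReal (ω ‖z‖)) * fun z => g z)
        (Complex.polarCoord.symm p) = 0 := by
    rw [setLIntegral_congr_fun (g := fun _ => 0)
      (polarCoord.open_target.measurableSet.diff (measurableSet_Ioo.prod measurableSet_Ioo))]
    · simp
    · rintro p ⟨hp1, hp2⟩
      have hp1' : p.1 ∈ Ioi 0 ∧ p.2 ∈ Ioo (-π) π := hp1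
      have : ¬ p.1 < 1 := fun h => hp2 ⟨⟨hp1'.1, h⟩, hp1'.2⟩
      have : Complex.polarCoord.symm p ∉ disc := by
        rw [disc, mem_ball_zero_iff, Complex.norm_polarCoord_symm, abs_of_pos hp1'.1]
        exact this
      simp only [indicator_of_notMem this, smul_zero]
  rw [h0, add_zero]
  have h1 : ∫⁻ p in Ioo (0 : ℝ) 1 ×ˢ Ioo (-π) π,
      ENNReal.ofReal p.1 • disc.indicator ((fun z => ENNReal.ofReal (ω ‖z‖)) * fun z => g z)
        (Complex.polarCoord.symm p) =
      ∫⁻ p in Ioo (0 : ℝ) 1 ×ˢ Ioo (-π) π,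
        ENNReal.ofReal (p.1 * ω p.1) * g (Complex.polarCoord.symm p) := by
    refine setLIntegral_congr_fun (measurableSet_Ioo.prod measurableSet_Ioo) fun p hp => ?_
    have hp0 : 0 < p.1 := hp.1.1
    have hn : ‖Complex.polarCoord.symm p‖ = p.1 := by
      rw [Complex.norm_polarCoord_symm, abs_of_pos hp0]
    have : Complex.polarCoord.symm p ∈ disc := by
      rw [disc, mem_ball_zero_iff, hn]; exact hp.1.2
    simp only [indicator_of_mem this, smul_eq_mul, Pi.mul_apply, hn]
    rw [ENNReal.ofReal_mul hp0.le, mul_assoc]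
  have hgm : Measurable fun p : ℝ × ℝ => g (Complex.polarCoord.symm p) :=
    
    (hg.comp Complex.measurableEquivRealProd.symm.measurable).comp
      continuous_polarCoord_symm.measurable
  rw [h1, Measure.volume_eq_prod, ← Measure.prod_restrict, lintegral_prod]
  · refine lintegral_congr fun s => ?_
    have hm : Measurable fun θ => g (Complex.polarCoord.symm (s, θ)) :=
      hgm.comp measurable_prodMk_left
    exact lintegral_const_mul (ENNReal.ofReal (s * ω s)) hm
  · refine AEMeasurable.mul ?_ hgm.aemeasurable
    have : AEMeasurable (fun s => ENNReal.ofReal (s * ω s)) (volume.restrict (Ioo 0 1)) :=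
      (measurable_id.aemeasurable.mul hω.aemeasurable).ennreal_ofReal
    exact this.comp_fst

end Polar

/-! ### Tails, moments and the associated weight -/

section Weight

open Real Set

variable {ω : ℝ → ℝ}

theorem tail_anti {r t : ℝ} (h : r ≤ t) : tail ω t ≤ tail ω r :=
  lintegral_mono_set (Ioo_subset_Ioo_left h)

theorem IsRadialWeight.tail_ne_top (hω : IsRadialWeight ω) {r : ℝ} (hr : 0 < r) :
    tail ω r ≠ ∞ := by
  have h1 : tail ω r ≤ ∫⁻ s in Ioo 0 1, ENNReal.ofReal (r⁻¹ * (s * ω s)) := by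
    refine (setLIntegral_mono' measurableSet_Ioo fun s hs => ?_).trans
      (lintegral_mono_set (Ioo_subset_Ioo_left hr.le))
    refine ENNReal.ofReal_le_ofReal ?_
    have h0 := hω.nonneg s (hr.le.trans hs.1.le) hs.2
    rw [← mul_assoc, ← div_eq_inv_mul]
    exact le_mul_of_one_le_left h0 ((one_le_div hr).2 hs.1.le)
  refine (h1.trans_lt ?_).ne
  exact (hω.integrableOn_mul.const_mul r⁻¹).lintegral_lt_top

/-- Integrability on the disc controls only `s * ω s`, so `ω` might fail to be integrable at `0`;
doubling at `r = 0` bounds the full integral by the tail from `1/2`. -/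
theorem IsDoubling.tail_ne_top (hω : IsDoubling ω) {r : ℝ} (hr : 0 ≤ r) : tail ω r ≠ ∞ := by
  obtain ⟨C, hC⟩ := hω.doubling
  have h := hC 0 le_rfl zero_lt_one
  refine ((tail_anti hr).trans_lt (h.trans_lt ?_)).ne
  exact ENNReal.mul_lt_top ENNReal.coe_lt_top
    (hω.toIsRadialWeight.tail_ne_top (by norm_num)).lt_top

theorem IsDoubling.integrableOn (hω : IsDoubling ω) : IntegrableOn ω (Ioo 0 1) := by
  refine ⟨hω.toIsRadialWeight.aemeasurable.aestronglyMeasurable, ?_⟩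
  rw [hasFiniteIntegral_iff_ofReal]
  · exact (hω.tail_ne_top le_rfl).lt_top
  · filter_upwards [ae_restrict_mem measurableSet_Ioo] with s hs
    exact hω.nonneg s hs.1.le hs.2

theorem IsDoubling.toReal_tail (hω : IsDoubling ω) {r : ℝ} (hr : 0 ≤ r) :
    (tail ω r).toReal = ∫ s in Ioo r 1, ω s := by
  rw [tail, integral_eq_lintegral_of_nonneg_ae]
  · filter_upwards [ae_restrict_mem measurableSet_Ioo] with s hs
    exact hω.nonneg s (hr.trans hs.1.le) hs.2
  · exact (hω.integrableOn.mono_set (Ioo_subset_Ioo_left hr)).aestronglyMeasurable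

/-- Iteration of the doubling condition. -/
theorem IsDoubling.exists_lintegral_pow_le (hω : IsDoubling ω) :
    ∃ (m : ℕ) (A : ℝ≥0), ∀ r, 0 ≤ r → r < 1 →
      ∫⁻ s in Ioc 0 r, ENNReal.ofReal (((1 - r) / (1 - s)) ^ m * ω s) ≤ A * tail ω r := by
  obtain ⟨C, hC⟩ := hω.doubling
  -- With `2C < 2 ^ m`, the gain `2 ^ (-m)` from doubling the distance to `1` absorbs the inductive
  -- constant `2C`.
  obtain ⟨m, hm⟩ := pow_unbounded_of_one_lt (2 * C : ℝ≥0) (one_lt_two : (1 : ℝ≥0) < 2)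
  refine ⟨m, 2 * C, ?_⟩
  have hle : ∀ r r', 0 ≤ r' → r < 1 → ∫⁻ s in Ioc r' r,
      ENNReal.ofReal (((1 - r) / (1 - s)) ^ m * ω s) ≤ tail ω r' := by
    intro r r' hr' hr
    refine (setLIntegral_mono' measurableSet_Ioc fun s hs => ?_).trans
      (lintegral_mono_set (fun s hs => ⟨hs.1, hs.2.trans_lt hr⟩))
    refine ENNReal.ofReal_le_ofReal (mul_le_of_le_one_left
      (hω.nonneg s (hr'.trans hs.1.le) (hs.2.trans_lt hr)) (pow_le_one₀ ?_ ?_))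
    · exact div_nonneg (by linarith) (by linarith [hs.2])
    · exact div_le_one_of_le₀ (by linarith [hs.2]) (by linarith [hs.2])
  -- Induction on the dyadic scale of `1 - r`: the step passes from `r` to `r' = 2r - 1`, for which
  -- `1 - r' = 2 (1 - r)` and `(1 + r') / 2 = r`.
  have key : ∀ k : ℕ, ∀ r, 0 ≤ r → r < 1 → 1 ≤ 2 ^ k * (1 - r) →
      ∫⁻ s in Ioc 0 r, ENNReal.ofReal (((1 - r) / (1 - s)) ^ m * ω s) ≤
        ((2 * C : ℝ≥0) : ℝ≥0∞) * tail ω r := by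
    intro k
    induction k with
    | zero =>
      intro r hr0 hr1 h
      have : r = 0 := by linarith
      simp [this]
    | succ k ih =>
      intro r hr0 hr1 h
      rcases le_or_gt r (1 / 2) with hr | hr
      · calc _ ≤ tail ω 0 := hle r 0 le_rfl hr1
          _ ≤ C * tail ω ((1 + 0) / 2) := hC 0 le_rfl zero_lt_one
          _ ≤ ((2 * C : ℝ≥0) : ℝ≥0∞) * tail ω r := by
            gcongr
            · exact le_mul_of_one_le_left zero_le one_le_two
            · exact tail_anti (by linarith)
      · set r' := 2 * r - 1 with hr'
        have hr'0 : 0 ≤ r' := by linarith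
        have hr'1 : r' < 1 := by linarith
        have hrr' : r' ≤ r := by linarith
        have ih' := ih r' hr'0 hr'1 (by rw [pow_succ] at h; rw [hr']; linarith)
        rw [← Ioc_union_Ioc_eq_Ioc hr'0 hrr', lintegral_union measurableSet_Ioc
          (Ioc_disjoint_Ioc_of_le le_rfl)]
        have h1 : ∫⁻ s in Ioc 0 r', ENNReal.ofReal (((1 - r) / (1 - s)) ^ m * ω s) ≤
            tail ω r' := by
          have : ∀ s, ENNReal.ofReal (((1 - r) / (1 - s)) ^ m * ω s) =
              (((2 : ℝ≥0) ^ m)⁻¹ : ℝ≥0) * ENNReal.ofReal (((1 - r') / (1 - s)) ^ m * ω s) := by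
            intro s
            rw [← ENNReal.ofReal_coe_nnreal, ← ENNReal.ofReal_mul (by positivity)]
            congr 1
            rw [hr', show 1 - (2 * r - 1) = 2 * (1 - r) by ring, mul_div_assoc, mul_pow]
            push_cast
            rw [mul_assoc, inv_mul_cancel_left₀ (by positivity)]
          simp only [this]
          rw [lintegral_const_mul' _ _ ENNReal.coe_ne_top]
          calc _ ≤ (((2 : ℝ≥0) ^ m)⁻¹ : ℝ≥0) * (((2 * C : ℝ≥0) : ℝ≥0∞) * tail ω r') := by gcongr
            _ ≤ 1 * tail ω r' := by
              rw [← mul_assoc]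
              gcongr
              rw [← ENNReal.coe_mul, ← ENNReal.coe_one, ENNReal.coe_le_coe]
              rw [inv_mul_le_iff₀ (by positivity), mul_one]
              exact hm.le
            _ = _ := one_mul _
        have h2 := hC r' hr'0 hr'1
        rw [show (1 + r') / 2 = r by rw [hr']; ring] at h2
        calc _ ≤ tail ω r' + tail ω r' := add_le_add h1 (hle r r' hr'0 hr1)
          _ ≤ C * tail ω r + C * tail ω r := add_le_add h2 h2
          _ = _ := by push_cast; ring
  intro r hr0 hr1
  obtain ⟨k, hk⟩ := pow_unbounded_of_one_lt (1 - r)⁻¹ one_lt_two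
  refine key k r hr0 hr1 ?_
  rw [inv_lt_iff_one_lt_mul₀ (by linarith)] at hk
  linarith

/-- Moments of a doubling weight are controlled by the tail integral. -/
theorem IsDoubling.exists_moment_le (hω : IsDoubling ω) :
    ∃ B : ℝ≥0, ∀ r : ℝ, 0 ≤ r → r < 1 → ∀ n : ℕ, 1 ≤ n * (1 - r) →
      ∫⁻ s in Ioo 0 1, ENNReal.ofReal (s ^ n * ω s) ≤ B * tail ω r := by
  obtain ⟨m, A, hA⟩ := hω.exists_lintegral_pow_le
  refine ⟨m.factorial * A + 1, fun r hr0 hr1 n hn => ?_⟩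
  rw [← Ioc_union_Ioo_eq_Ioo hr0 hr1, lintegral_union measurableSet_Ioo
    (Set.disjoint_left.2 fun s hs hs' => hs.2.not_gt hs'.1)]
  have h1 : ∫⁻ s in Ioc 0 r, ENNReal.ofReal (s ^ n * ω s) ≤
      m.factorial * ∫⁻ s in Ioc 0 r, ENNReal.ofReal (((1 - r) / (1 - s)) ^ m * ω s) := by
    rw [← lintegral_const_mul' _ _ (ENNReal.natCast_ne_top _)]
    refine setLIntegral_mono' measurableSet_Ioc fun s hs => ?_
    have hs1 : s < 1 := hs.2.trans_lt hr1
    rw [← ENNReal.ofReal_natCast, ← ENNReal.ofReal_mul (by positivity), ← mul_assoc]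
    refine ENNReal.ofReal_le_ofReal (mul_le_mul_of_nonneg_right ?_ (hω.nonneg s hs.1.le hs1))
    -- `s ^ n ≤ exp (-x) ≤ m! x ^ (-m)`, and `n (1 - r) ≥ 1` turns `1 / x` into `(1 - r) / (1 - s)`.
    set x := n * (1 - s) with hx
    have hn0 : (0 : ℝ) < n := by
      by_contra h
      have : (n : ℝ) * (1 - r) ≤ 0 := mul_nonpos_of_nonpos_of_nonneg (not_lt.1 h) (by linarith)
      linarith
    have hx0 : 0 < x := mul_pos hn0 (by linarith)
    have h2 : s ^ n ≤ Real.exp (-x) := by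
      have : s ≤ Real.exp (-(1 - s)) := by
        have := Real.add_one_le_exp (-(1 - s)); linarith
      calc s ^ n ≤ Real.exp (-(1 - s)) ^ n := pow_le_pow_left₀ hs.1.le this n
        _ = Real.exp (-x) := by rw [← Real.exp_nat_mul, hx]; congr 1; ring
    have h3 := Real.pow_div_factorial_le_exp x hx0.le m
    have h4 : Real.exp (-x) ≤ m.factorial * x⁻¹ ^ m := by
      rw [Real.exp_neg, inv_pow, ← div_eq_mul_inv, le_div_iff₀ (by positivity),
        inv_mul_le_iff₀ (Real.exp_pos _)]
      rwa [div_le_iff₀ (by positivity)] at h3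
    have h5 : x⁻¹ ≤ (1 - r) / (1 - s) := by
      rw [inv_le_iff_one_le_mul₀ hx0, hx]
      have : (1 - r) / (1 - s) * (n * (1 - s)) = n * (1 - r) := by
        have : (1 - s) ≠ 0 := by linarith
        field_simp
      rw [this]; exact hn
    exact (h2.trans h4).trans (mul_le_mul_of_nonneg_left
      (pow_le_pow_left₀ (by positivity) h5 m) (by positivity))
  have h2 : ∫⁻ s in Ioo r 1, ENNReal.ofReal (s ^ n * ω s) ≤ tail ω r := by
    refine setLIntegral_mono' measurableSet_Ioo fun s hs => ENNReal.ofReal_le_ofReal ?_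
    have hs0 : 0 ≤ s := hr0.trans hs.1.le
    exact mul_le_of_le_one_left (hω.nonneg s hs0 hs.2) (pow_le_one₀ hs0 hs.2.le)
  calc _ ≤ m.factorial * (A * tail ω r) + tail ω r :=
        add_le_add (h1.trans (by gcongr; exact hA r hr0 hr1)) h2
    _ = _ := by push_cast; ring

theorem IsDoubling.integrableOn_omegaStar (hω : IsDoubling ω) {r : ℝ} (hr : 0 < r) :
    IntegrableOn (fun s => ω s * log (s / r) * s) (Ioo r 1) := by
  have h1 : IntegrableOn ω (Ioo r 1) := hω.integrableOn.mono_set (Ioo_subset_Ioo_left hr.le)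
  have h2 : IntegrableOn (fun s => ω s * (log (s / r) * s)) (Ioo r 1) := by
    refine Integrable.mul_bdd (c := 1 / r) h1 (by fun_prop) ?_
    filter_upwards [ae_restrict_mem measurableSet_Ioo] with s hs
    have hs0 : 0 < s := hr.trans hs.1
    have h3 : 0 ≤ log (s / r) := log_nonneg ((one_le_div hr).2 hs.1.le)
    have h4 : log (s / r) ≤ s / r := (log_le_sub_one_of_pos (by positivity)).trans (by linarith)
    rw [norm_of_nonneg (by positivity)]
    calc log (s / r) * s ≤ s / r * s := by gcongr
      _ ≤ 1 / r * 1 := by gcongr <;> exact hs.2.le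
      _ = 1 / r := mul_one _
  simpa only [mul_assoc] using h2

/-- Follows from `log t ≤ t - 1`. The restriction `‖z‖ ≥ 1/2` keeps the factor `1 / ‖z‖` below `2`.
-/
theorem IsDoubling.omegaStar_le (hω : IsDoubling ω) {z : ℂ} (hz : 1 / 2 ≤ ‖z‖) :
    omegaStar ω z ≤ 2 * (1 - ‖z‖) * (tail ω ‖z‖).toReal := by
  have hz0 : 0 < ‖z‖ := by linarith
  rw [hω.toReal_tail hz0.le, ← integral_const_mul, omegaStar]
  refine setIntegral_mono_on (hω.integrableOn_omegaStar hz0)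
    ((hω.integrableOn.mono_set (Ioo_subset_Ioo_left hz0.le)).const_mul _) measurableSet_Ioo
    fun s hs => ?_
  have hs0 : 0 < s := hz0.trans hs.1
  have hω0 := hω.nonneg s hs0.le hs.2
  have h4 : log (s / ‖z‖) * s ≤ 2 * (1 - ‖z‖) := by
    calc log (s / ‖z‖) * s ≤ (s / ‖z‖ - 1) * s := by
          gcongr; exact log_le_sub_one_of_pos (by positivity)
      _ ≤ (s / ‖z‖ - 1) * 1 := by
          gcongr
          · rw [sub_nonneg, one_le_div hz0]; exact hs.1.le
          · exact hs.2.le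
      _ ≤ 2 * (1 - ‖z‖) := by
          rw [mul_one, sub_le_iff_le_add, div_le_iff₀ hz0]
          nlinarith [hs.2, hs.1, mul_nonneg (show 0 ≤ 1 - ‖z‖ by linarith [hs.1, hs.2])
            (show 0 ≤ 2 * ‖z‖ - 1 by linarith)]
  nlinarith

/-- Follows from `log t ≥ 1 - 1/t`, keeping only the `s` beyond the midpoint of `‖z‖` and `1`, where
`s - ‖z‖ ≥ (1 - ‖z‖) / 2`. -/
theorem IsDoubling.le_omegaStar (hω : IsDoubling ω) {z : ℂ} (hz0 : 0 < ‖z‖) (hz1 : ‖z‖ < 1) :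
    (1 - ‖z‖) / 2 * (tail ω ((1 + ‖z‖) / 2)).toReal ≤ omegaStar ω z := by
  rw [hω.toReal_tail (by positivity), ← integral_const_mul, omegaStar]
  have hsub : Ioo ((1 + ‖z‖) / 2) 1 ⊆ Ioo ‖z‖ 1 := Ioo_subset_Ioo_left (by linarith)
  refine (setIntegral_mono_on (g := fun s => ω s * log (s / ‖z‖) * s)
    ((hω.integrableOn.mono_set (Ioo_subset_Ioo_left (by positivity))).const_mul _)
    ((hω.integrableOn_omegaStar hz0).mono_set hsub) measurableSet_Ioo
    fun s hs => ?_).trans (setIntegral_mono_set (hω.integrableOn_omegaStar hz0) ?_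
      hsub.eventuallyLE)
  · have hs0 : 0 < s := by linarith [hs.1]
    have hω0 := hω.nonneg s hs0.le hs.2
    have h1 : (1 - ‖z‖) / 2 ≤ log (s / ‖z‖) * s := by
      have := one_sub_inv_le_log_of_pos (show 0 < s / ‖z‖ by positivity)
      calc (1 - ‖z‖) / 2 ≤ s - ‖z‖ := by linarith [hs.1]
        _ = (1 - (s / ‖z‖)⁻¹) * s := by field_simp
        _ ≤ _ := by gcongr
    nlinarith
  · filter_upwards [ae_restrict_mem measurableSet_Ioo] with s hs
    have hs0 : 0 < s := by linarith [hs.1]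
    have h3 : 0 ≤ log (s / ‖z‖) := log_nonneg ((one_le_div hz0).2 hs.1.le)
    have hω0 := hω.nonneg s hs0.le hs.2
    simp only [Pi.zero_apply]
    positivity

theorem IsDoubling.toReal_tail_pos (hω : IsDoubling ω) {r : ℝ} (hr0 : 0 ≤ r) (hr1 : r < 1) :
    0 < (tail ω r).toReal :=
  ENNReal.toReal_pos (hω.tail_pos r hr0 hr1).ne' (hω.tail_ne_top hr0)

theorem IsDoubling.omegaStar_pos (hω : IsDoubling ω) {z : ℂ} (hz0 : 0 < ‖z‖) (hz1 : ‖z‖ < 1) :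
    0 < omegaStar ω z :=
  lt_of_lt_of_le (mul_pos (by linarith) (hω.toReal_tail_pos (by positivity) (by linarith)))
    (hω.le_omegaStar hz0 hz1)

/-- As `ω` is only a.e. measurable, a measurable representative is integrated over the fixed
interval `(0, 1)`, with a cutoff replacing the moving endpoint. -/
theorem IsRadialWeight.measurable_omegaStar (hω : IsRadialWeight ω) :
    Measurable (omegaStar ω) := by
  have hm := hω.aemeasurable
  have h1 : omegaStar ω = fun z : ℂ => ∫ s in Ioo (0 : ℝ) 1,
      (if ‖z‖ < s then hm.mk ω s * log (s / ‖z‖) * s else 0) := by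
    ext z
    have h2 : ∫ s in Ioo (0 : ℝ) 1, (if ‖z‖ < s then hm.mk ω s * log (s / ‖z‖) * s else 0) =
        ∫ s in Ioo (0 : ℝ) 1, (Ioo ‖z‖ 1).indicator (fun s => ω s * log (s / ‖z‖) * s) s := by
      refine integral_congr_ae ?_
      filter_upwards [ae_restrict_mem measurableSet_Ioo, hm.ae_eq_mk] with s hs hs'
      by_cases h : ‖z‖ < s
      · rw [if_pos h, indicator_of_mem (show s ∈ Ioo ‖z‖ 1 from ⟨h, hs.2⟩), hs']
      · rw [if_neg h, indicator_of_notMem fun h' => h h'.1]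
    rw [h2, setIntegral_indicator measurableSet_Ioo, inter_eq_self_of_subset_right
      (Ioo_subset_Ioo_left (norm_nonneg z)), omegaStar]
  rw [h1]
  have h3 : StronglyMeasurable fun p : ℂ × ℝ =>
      if ‖p.1‖ < p.2 then hm.mk ω p.2 * log (p.2 / ‖p.1‖) * p.2 else 0 := by
    refine Measurable.stronglyMeasurable (Measurable.ite (measurableSet_lt (by fun_prop)
      (by fun_prop)) ?_ measurable_const)
    have := hm.measurable_mk
    fun_prop
  exact h3.integral_prod_right.measurable

end Weight

/-! ### The basic point evaluation estimate -/

section PointEvaluation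

open Real Set

variable {ω : ℝ → ℝ}

theorem ae_mem_disc : ∀ᵐ z ∂area, z ∈ disc :=
  Measure.ae_smul_measure (ae_restrict_mem measurableSet_disc) _

theorem ae_weightMeasure_mem_disc : ∀ᵐ z ∂(weightMeasure ω), z ∈ disc :=
  (withDensity_absolutelyContinuous _ _).ae_le ae_mem_disc

theorem measurable_indicator_disc {f : ℂ → ℂ} (hf : ContinuousOn f disc) :
    Measurable (disc.indicator f) := by
  classical
  rw [← piecewise_eq_indicator]
  exact hf.measurable_piecewise continuousOn_const measurableSet_disc

/-- Analytic functions are controlled at a point by their mass outside a larger disc. -/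
theorem IsRadialWeight.enorm_sq_le (hω : IsRadialWeight ω) {f : ℂ → ℂ}
    (hf : DifferentiableOn ℂ f disc) {z : ℂ} (hz : ‖z‖ < 1) :
    ENNReal.ofReal ((1 - ‖z‖) / 4 * ‖f z‖ ^ 2) * tail ω ((1 + ‖z‖) / 2) ≤
      ∫⁻ w in {w | (1 + ‖z‖) / 2 < ‖w‖}, ‖f w‖ₑ ^ 2 ∂(weightMeasure ω) := by
  set ρ := (1 + ‖z‖) / 2 with hρ
  have hz0 := norm_nonneg z
  have hms : MeasurableSet {w : ℂ | ρ < ‖w‖} := measurableSet_lt measurable_const (by fun_prop)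
  have hgm : Measurable ({w : ℂ | ρ < ‖w‖}.indicator fun w => ‖disc.indicator f w‖ₑ ^ 2) :=
    ((measurable_indicator_disc hf.continuousOn).enorm.pow_const 2).indicator hms
  have hR : ∫⁻ w in {w | ρ < ‖w‖}, ‖f w‖ₑ ^ 2 ∂(weightMeasure ω) =
      ∫⁻ w, {w : ℂ | ρ < ‖w‖}.indicator (fun w => ‖disc.indicator f w‖ₑ ^ 2) w
        ∂(weightMeasure ω) := by
    rw [← lintegral_indicator hms]
    refine lintegral_congr_ae ?_
    filter_upwards [ae_weightMeasure_mem_disc] with w hw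
    simp only [indicator, hw, if_true]
  rw [hR, lintegral_weightMeasure hω hgm]
  -- For `s > ρ`, the midpoint of `‖z‖` and `1`, the Poisson factor `(s - ‖z‖) / (s + ‖z‖)` is at
  -- least `(1 - ‖z‖) / 4`.
  have hin : ∀ s ∈ Ioo ρ 1, ENNReal.ofReal (2 * π * ((1 - ‖z‖) / 4 * ‖f z‖ ^ 2)) ≤
      ∫⁻ θ in Ioo (-π) π, {w : ℂ | ρ < ‖w‖}.indicator (fun w => ‖disc.indicator f w‖ₑ ^ 2)
        (Complex.polarCoord.symm (s, θ)) := by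
    intro s hs
    have hs0 : 0 < s := by linarith [hs.1]
    have hc := continuousOn_sphere_of_disc hf hs0 hs.2
    have h1 := lintegral_circle (u := fun w => ‖f w‖ ^ 2) (hc.norm.pow 2)
      fun w _ => by positivity
    have h2 : ∀ θ, {w : ℂ | ρ < ‖w‖}.indicator (fun w => ‖disc.indicator f w‖ₑ ^ 2)
        (Complex.polarCoord.symm (s, θ)) =
        ENNReal.ofReal (‖f (Complex.polarCoord.symm (s, θ))‖ ^ 2) := by
      intro θ
      have hn : ‖Complex.polarCoord.symm (s, θ)‖ = s := by
        rw [Complex.norm_polarCoord_symm, abs_of_pos hs0]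
      rw [indicator_of_mem (show _ ∈ {w : ℂ | ρ < ‖w‖} by rw [mem_ofPred_eq, hn]; exact hs.1),
        indicator_of_mem (show _ ∈ disc by rw [disc, mem_ball_zero_iff, hn]; exact hs.2),
        ENNReal.ofReal_pow (norm_nonneg _), ofReal_norm]
    simp only [h2]
    rw [h1]
    have hzs : ‖z‖ < s := by linarith [hs.1]
    have h3 := norm_sq_le_circleAverage hf hs0 hs.2 hzs
    refine ENNReal.ofReal_le_ofReal (mul_le_mul_of_nonneg_left (le_trans ?_ h3) (by positivity))
    refine mul_le_mul_of_nonneg_right ?_ (by positivity)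
    rw [div_le_div_iff₀ (by norm_num) (by positivity)]
    nlinarith [hs.1, hs.2]
  -- The factor `1/2` is a lower bound for the Jacobian `s`, since `s > ρ ≥ 1/2`.
  calc _ = ENNReal.ofReal (1 / π) * ∫⁻ s in Ioo ρ 1, ENNReal.ofReal (ω s) *
        ENNReal.ofReal (1 / 2 * (2 * π * ((1 - ‖z‖) / 4 * ‖f z‖ ^ 2))) := by
        rw [lintegral_mul_const' _ _ ENNReal.ofReal_ne_top, mul_left_comm,
          ← ENNReal.ofReal_mul (by positivity), mul_comm]
        congr 2
        field_simp
    _ ≤ ENNReal.ofReal (1 / π) * ∫⁻ s in Ioo ρ 1, ENNReal.ofReal (s * ω s) *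
        ∫⁻ θ in Ioo (-π) π, {w : ℂ | ρ < ‖w‖}.indicator (fun w => ‖disc.indicator f w‖ₑ ^ 2)
          (Complex.polarCoord.symm (s, θ)) := by
        gcongr ENNReal.ofReal (1 / π) * ?_
        refine setLIntegral_mono' measurableSet_Ioo fun s hs => ?_
        have hs0 : 0 < s := by linarith [hs.1]
        have hω0 := hω.nonneg s hs0.le hs.2
        rw [ENNReal.ofReal_mul (by norm_num), ← mul_assoc, ← ENNReal.ofReal_mul hω0]
        refine mul_le_mul' (ENNReal.ofReal_le_ofReal ?_) (hin s hs)
        nlinarith [hs.1]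
    _ ≤ _ := by
        gcongr ENNReal.ofReal (1 / π) * ?_
        exact lintegral_mono_set (Ioo_subset_Ioo_left (by positivity))

end PointEvaluation

/-! ### Completeness of the Bergman space and existence of kernels -/

section Space

open Real Set Filter Topology

variable {ω : ℝ → ℝ}

/-- The inner product of `A²_ω` inherited from `L²`. -/
noncomputable abbrev A2.hilbertInner (ω : ℝ → ℝ) : Inner ℂ (A2 ω) := InnerProductSpace.toInner

attribute [local instance] A2.hilbertInner

theorem A2.differentiableOn_toFun (f : A2 ω) : DifferentiableOn ℂ (A2.toFun f) disc :=
  (Classical.choose_spec f.2).1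

theorem A2.ae_eq_toFun (f : A2 ω) : (f : Lp ℂ 2 (weightMeasure ω)) =ᵐ[weightMeasure ω] A2.toFun f :=
  (Classical.choose_spec f.2).2

theorem eLpNorm_two_sq (f : ℂ → ℂ) (μ : Measure ℂ) :
    eLpNorm f 2 μ ^ 2 = ∫⁻ w, ‖f w‖ₑ ^ 2 ∂μ := by
  have := eLpNorm_nnreal_pow_eq_lintegral (f := f) (μ := μ) (p := 2) two_ne_zero
  simpa using this

theorem A2.ofReal_norm_sq (f : A2 ω) :
    ENNReal.ofReal (‖f‖ ^ 2) = ∫⁻ w, ‖A2.toFun f w‖ₑ ^ 2 ∂(weightMeasure ω) := by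
  rw [ENNReal.ofReal_pow (norm_nonneg _), Submodule.coe_norm, ofReal_norm, Lp.enorm_def,
    eLpNorm_two_sq]
  refine lintegral_congr_ae ?_
  filter_upwards [A2.ae_eq_toFun f] with w hw
  rw [hw]

theorem aestronglyMeasurable_of_disc {f : ℂ → ℂ} (hf : DifferentiableOn ℂ f disc) :
    AEStronglyMeasurable f (weightMeasure ω) := by
  refine ⟨disc.indicator f, (measurable_indicator_disc hf.continuousOn).stronglyMeasurable, ?_⟩
  filter_upwards [ae_weightMeasure_mem_disc] with w hw
  rw [indicator_of_mem hw]

/-- The weight may vanish on large sets, but every tail is positive, so the point estimate applied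
to `f - g` forces it to vanish at each point. -/
theorem IsDoubling.eqOn_disc (hω : IsDoubling ω) {f g : ℂ → ℂ} (hf : DifferentiableOn ℂ f disc)
    (hg : DifferentiableOn ℂ g disc) (h : f =ᵐ[weightMeasure ω] g) : EqOn f g disc := by
  intro z hz
  have hz' : ‖z‖ < 1 := by simpa [disc] using hz
  have h1 := hω.toIsRadialWeight.enorm_sq_le (hf.sub hg) hz'
  have h2 : ∫⁻ w in {w | (1 + ‖z‖) / 2 < ‖w‖}, ‖(f - g) w‖ₑ ^ 2 ∂(weightMeasure ω) = 0 := by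
    rw [← nonpos_iff_eq_zero]
    refine (setLIntegral_le_lintegral _ _).trans (le_of_eq ?_)
    rw [lintegral_congr_ae (g := fun _ => 0), lintegral_zero]
    filter_upwards [h] with w hw
    simp [hw]
  rw [show (f - g) = fun w => f w - g w from rfl] at h2
  rw [Pi.sub_def, h2, nonpos_iff_eq_zero, mul_eq_zero] at h1
  rcases h1 with h1 | h1
  · rw [ENNReal.ofReal_eq_zero] at h1
    by_contra hne
    have h3 : 0 < ‖f z - g z‖ := norm_pos_iff.2 (sub_ne_zero.2 hne)
    have h4 : 0 < (1 - ‖z‖) / 4 := by linarith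
    exact h1.not_gt (by positivity)
  · exact absurd h1 (hω.tail_pos _ (by positivity) (by linarith)).ne'

theorem IsDoubling.toFun_add (hω : IsDoubling ω) (f g : A2 ω) :
    EqOn (A2.toFun (f + g)) (A2.toFun f + A2.toFun g) disc := by
  refine hω.eqOn_disc (A2.differentiableOn_toFun _)
    ((A2.differentiableOn_toFun f).add (A2.differentiableOn_toFun g)) ?_
  filter_upwards [A2.ae_eq_toFun f, A2.ae_eq_toFun g, A2.ae_eq_toFun (f + g),
    Lp.coeFn_add (f : Lp ℂ 2 (weightMeasure ω)) g] with w h1 h2 h3 h4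
  rw [← h3, Submodule.coe_add, h4, Pi.add_apply, Pi.add_apply, h1, h2]

theorem IsDoubling.toFun_smul (hω : IsDoubling ω) (c : ℂ) (f : A2 ω) :
    EqOn (A2.toFun (c • f)) (c • A2.toFun f) disc := by
  refine hω.eqOn_disc (A2.differentiableOn_toFun _)
    ((A2.differentiableOn_toFun f).const_smul c) ?_
  filter_upwards [A2.ae_eq_toFun f, A2.ae_eq_toFun (c • f),
    Lp.coeFn_smul c (f : Lp ℂ 2 (weightMeasure ω))] with w h1 h3 h4
  rw [← h3, Submodule.coe_smul, h4, Pi.smul_apply, Pi.smul_apply, h1]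

theorem IsDoubling.exists_toFun_eq (hω : IsDoubling ω) {g : ℂ → ℂ} (hg : DifferentiableOn ℂ g disc)
    (hfin : ∫⁻ w, ‖g w‖ₑ ^ 2 ∂(weightMeasure ω) ≠ ∞) :
    ∃ f : A2 ω, EqOn (A2.toFun f) g disc ∧
      ENNReal.ofReal (‖f‖ ^ 2) = ∫⁻ w, ‖g w‖ₑ ^ 2 ∂(weightMeasure ω) := by
  have hm : MemLp g 2 (weightMeasure ω) := by
    refine ⟨aestronglyMeasurable_of_disc hg, ?_⟩
    rw [← eLpNorm_two_sq] at hfin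
    rw [lt_top_iff_ne_top]
    rintro h
    rw [h] at hfin
    exact hfin (by simp)
  let f : A2 ω := ⟨hm.toLp g, g, hg, hm.coeFn_toLp⟩
  have hf : A2.toFun f =ᵐ[weightMeasure ω] g := (A2.ae_eq_toFun f).symm.trans hm.coeFn_toLp
  refine ⟨f, hω.eqOn_disc (A2.differentiableOn_toFun f) hg hf, ?_⟩
  rw [A2.ofReal_norm_sq]
  refine lintegral_congr_ae ?_
  filter_upwards [hf] with w hw
  rw [hw]

/-- The constant in the estimate of point evaluations. -/
noncomputable def evalConst (ω : ℝ → ℝ) (r : ℝ) : ℝ :=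
  (1 - r) / 4 * (tail ω ((1 + r) / 2)).toReal

theorem IsDoubling.evalConst_pos (hω : IsDoubling ω) {r : ℝ} (hr0 : 0 ≤ r) (hr1 : r < 1) :
    0 < evalConst ω r :=
  mul_pos (by linarith) (hω.toReal_tail_pos (by positivity) (by linarith))

theorem IsDoubling.evalConst_anti (hω : IsDoubling ω) {r t : ℝ} (hr0 : 0 ≤ r) (hrt : r ≤ t)
    (ht : t < 1) : evalConst ω t ≤ evalConst ω r := by
  have h := ENNReal.toReal_mono (hω.tail_ne_top (by positivity))
    (tail_anti (ω := ω) (show (1 + r) / 2 ≤ (1 + t) / 2 by linarith))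
  unfold evalConst
  gcongr
  linarith

/-- Point evaluations are bounded. -/
theorem IsDoubling.evalConst_mul_norm_sq_le (hω : IsDoubling ω) (f : A2 ω) {z : ℂ}
    (hz : z ∈ disc) : evalConst ω ‖z‖ * ‖A2.toFun f z‖ ^ 2 ≤ ‖f‖ ^ 2 := by
  have hz' : ‖z‖ < 1 := by simpa [disc] using hz
  have h1 := (hω.toIsRadialWeight.enorm_sq_le (A2.differentiableOn_toFun f) hz').trans
    (setLIntegral_le_lintegral _ _)
  rw [← A2.ofReal_norm_sq, ← ENNReal.ofReal_toReal (hω.tail_ne_top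
    (show 0 ≤ (1 + ‖z‖) / 2 by positivity)), ← ENNReal.ofReal_mul
    (mul_nonneg (by linarith) (by positivity)), ENNReal.ofReal_le_ofReal_iff (by positivity)] at h1
  unfold evalConst
  linarith

theorem IsDoubling.toFun_sub (hω : IsDoubling ω) (f g : A2 ω) {z : ℂ} (hz : z ∈ disc) :
    A2.toFun (f - g) z = A2.toFun f z - A2.toFun g z := by
  have h := hω.toFun_add (f - g) g hz
  rw [sub_add_cancel, Pi.add_apply] at h
  rw [h, add_sub_cancel_right]

/-- Bounded point evaluations upgrade norm convergence to locally uniform convergence, whose limit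
is analytic; an a.e. convergent subsequence identifies it with the `L²` limit. -/
theorem IsDoubling.isClosed_A2 (hω : IsDoubling ω) :
    IsClosed (A2 ω : Set (Lp ℂ 2 (weightMeasure ω))) := by
  refine IsSeqClosed.isClosed fun F f hF hlim => ?_
  let u : ℕ → A2 ω := fun n => ⟨F n, hF n⟩
  have hcau : CauchySeq F := hlim.cauchySeq
  have hunif : ∀ R : ℝ, 0 ≤ R → R < 1 →
      UniformCauchySeqOn (fun n => A2.toFun (u n)) atTop (Metric.closedBall 0 R) := by
    intro R hR0 hR1
    rw [Metric.uniformCauchySeqOn_iff]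
    intro ε hε
    have hc := hω.evalConst_pos hR0 hR1
    obtain ⟨N, hN⟩ := Metric.cauchySeq_iff.1 hcau (√(evalConst ω R) * ε) (by positivity)
    refine ⟨N, fun m hm n hn z hz => ?_⟩
    rw [mem_closedBall_zero_iff] at hz
    have hzd : z ∈ disc := by simpa [disc] using hz.trans_lt hR1
    have h1 := hω.evalConst_mul_norm_sq_le (u m - u n) hzd
    rw [hω.toFun_sub _ _ hzd] at h1
    have h2 : ‖u m - u n‖ < √(evalConst ω R) * ε := by
      have := hN m hm n hn
      rwa [dist_eq_norm] at this
    have h3 := hω.evalConst_anti (norm_nonneg z) hz hR1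
    have h4 : evalConst ω R * ‖A2.toFun (u m) z - A2.toFun (u n) z‖ ^ 2 < evalConst ω R * ε ^ 2 :=
      calc _ ≤ evalConst ω ‖z‖ * ‖A2.toFun (u m) z - A2.toFun (u n) z‖ ^ 2 := by gcongr
        _ ≤ ‖u m - u n‖ ^ 2 := h1
        _ < (√(evalConst ω R) * ε) ^ 2 := by gcongr
        _ = _ := by rw [mul_pow, Real.sq_sqrt hc.le]
    rw [dist_eq_norm]
    exact lt_of_pow_lt_pow_left₀ 2 hε.le (lt_of_mul_lt_mul_left h4 hc.le)
  have hpt : ∀ z : ℂ, ∃ l, z ∈ disc → Tendsto (fun n => A2.toFun (u n) z) atTop (𝓝 l) := by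
    intro z
    by_cases hz : z ∈ disc
    · have hz' : ‖z‖ < 1 := by simpa [disc] using hz
      have := (hunif ‖z‖ (norm_nonneg z) hz').cauchySeq (x := z) (by simp)
      obtain ⟨l, hl⟩ := cauchySeq_tendsto_of_complete this
      exact ⟨l, fun _ => hl⟩
    · exact ⟨0, fun h => absurd h hz⟩
  choose g hg using hpt
  have hloc : TendstoLocallyUniformlyOn (fun n => A2.toFun (u n)) g atTop disc := by
    intro v hv z hz
    have hz' : ‖z‖ < 1 := by simpa [disc] using hz
    refine ⟨Metric.closedBall 0 ((1 + ‖z‖) / 2), mem_nhdsWithin_of_mem_nhds ?_, ?_⟩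
    · refine mem_of_superset (Metric.isOpen_ball.mem_nhds ?_) Metric.ball_subset_closedBall
      rw [mem_ball_zero_iff]; linarith
    · refine ((hunif _ (by positivity) (by linarith)).tendstoUniformlyOn_of_tendsto
        fun w hw => hg w ?_) v hv
      rw [mem_closedBall_zero_iff] at hw
      rw [disc, mem_ball_zero_iff]; linarith
  have hgd : DifferentiableOn ℂ g disc :=
    hloc.differentiableOn (Eventually.of_forall fun n => A2.differentiableOn_toFun (u n))
      Metric.isOpen_ball
  refine ⟨g, hgd, ?_⟩
  obtain ⟨ns, hns, hae⟩ := (tendstoInMeasure_of_tendsto_Lp hlim).exists_seq_tendsto_ae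
  have hall : ∀ᵐ z ∂(weightMeasure ω), ∀ n, F n z = A2.toFun (u n) z :=
    ae_all_iff.2 fun n => A2.ae_eq_toFun (u n)
  filter_upwards [hae, hall, ae_weightMeasure_mem_disc] with z h1 h2 h3
  simp only [h2] at h1
  exact tendsto_nhds_unique h1 ((hg z h3).comp hns.tendsto_atTop)

theorem IsDoubling.completeSpace (hω : IsDoubling ω) : CompleteSpace (A2 ω) :=
  hω.isClosed_A2.completeSpace_coe

theorem IsDoubling.exists_isKernel (hω : IsDoubling ω) {z : ℂ} (hz : z ∈ disc) :
    ∃ B : A2 ω, IsKernel ω z B := by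
  have := hω.completeSpace
  have hz' : ‖z‖ < 1 := by simpa [disc] using hz
  have hc := hω.evalConst_pos (norm_nonneg z) hz'
  let L : A2 ω →ₗ[ℂ] ℂ :=
    { toFun := fun f => A2.toFun f z
      map_add' := fun f g => hω.toFun_add f g hz
      map_smul' := fun c f => hω.toFun_smul c f hz }
  let Lc : A2 ω →L[ℂ] ℂ := L.mkContinuous (√(evalConst ω ‖z‖))⁻¹ fun f => by
    have h := hω.evalConst_mul_norm_sq_le f hz
    rw [← div_eq_inv_mul, le_div_iff₀ (by positivity)]
    refine le_of_sq_le_sq ?_ (norm_nonneg _)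
    rw [mul_pow, Real.sq_sqrt hc.le]
    exact (mul_comm _ _).trans_le h
  refine ⟨(InnerProductSpace.toDual ℂ (A2 ω)).symm Lc, fun f => ?_⟩
  rw [InnerProductSpace.toDual_symm_apply]
  rfl

theorem IsDoubling.inner_kernel (hω : IsDoubling ω) {z : ℂ} (hz : z ∈ disc) (f : A2 ω) :
    inner ℂ (kernel ω z) f = A2.toFun f z := by
  have h := hω.exists_isKernel hz
  rw [kernel, dif_pos h]
  exact (h.choose_spec f).symm

theorem IsDoubling.norm_toFun_sq_le (hω : IsDoubling ω) {z : ℂ} (hz : z ∈ disc) (f : A2 ω) :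
    ‖A2.toFun f z‖ ^ 2 ≤ ‖kernel ω z‖ ^ 2 * ‖f‖ ^ 2 := by
  rw [← hω.inner_kernel hz, ← mul_pow]
  gcongr
  exact norm_inner_le_norm (𝕜 := ℂ) _ _

/-- Point evaluation is tested on `B_z` itself, for which `B_z(z) = ‖B_z‖²`. -/
theorem IsDoubling.evalConst_mul_norm_kernel_sq_le (hω : IsDoubling ω) {z : ℂ} (hz : z ∈ disc) :
    evalConst ω ‖z‖ * ‖kernel ω z‖ ^ 2 ≤ 1 := by
  have h := hω.evalConst_mul_norm_sq_le (kernel ω z) hz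
  rw [← hω.inner_kernel hz, inner_self_eq_norm_sq_to_K (𝕜 := ℂ), norm_pow, RCLike.norm_ofReal,
    abs_norm] at h
  by_cases h0 : ‖kernel ω z‖ = 0
  · simp [h0]
  · have : 0 < ‖kernel ω z‖ ^ 2 := by positivity
    nlinarith

theorem IsRadialWeight.isFiniteMeasure (hω : IsRadialWeight ω) :
    IsFiniteMeasure (weightMeasure ω) :=
  isFiniteMeasure_withDensity_ofReal (hω.integrable.2.smul_measure ENNReal.ofReal_ne_top)

end Space

/-! ### Two-sided estimates of the kernel norm -/

section KernelEstimates

open Real Set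

variable {ω : ℝ → ℝ}

/-- Upper bound for the norm of the kernel away from the origin. -/
theorem IsDoubling.exists_norm_kernel_sq_mul_omegaStar_le (hω : IsDoubling ω) :
    ∃ C : ℝ, 0 < C ∧ ∀ z ∈ disc, 1 / 2 ≤ ‖z‖ → ‖kernel ω z‖ ^ 2 * omegaStar ω z ≤ C := by
  obtain ⟨C, hC⟩ := hω.doubling
  refine ⟨8 * C + 1, by positivity, fun z hz hz2 => ?_⟩
  have hz' : ‖z‖ < 1 := by simpa [disc] using hz
  have h1 := hω.evalConst_mul_norm_kernel_sq_le hz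
  have h2 := hω.omegaStar_le hz2
  have h3 : (tail ω ‖z‖).toReal ≤ C * (tail ω ((1 + ‖z‖) / 2)).toReal := by
    have := ENNReal.toReal_mono (ENNReal.mul_ne_top ENNReal.coe_ne_top
      (hω.tail_ne_top (by positivity))) (hC ‖z‖ (norm_nonneg z) hz')
    simpa using this
  unfold evalConst at h1
  have h4 : 0 ≤ 2 * (1 - ‖z‖) := by linarith
  calc ‖kernel ω z‖ ^ 2 * omegaStar ω z
      ≤ ‖kernel ω z‖ ^ 2 * (2 * (1 - ‖z‖) * (C * (tail ω ((1 + ‖z‖) / 2)).toReal)) := by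
        gcongr
        exact h2.trans (by gcongr)
    _ = 8 * C * ((1 - ‖z‖) / 4 * (tail ω ((1 + ‖z‖) / 2)).toReal * ‖kernel ω z‖ ^ 2) := by ring
    _ ≤ 8 * C * 1 := by gcongr
    _ ≤ 8 * C + 1 := by linarith

theorem one_sub_conj_mul_ne_zero {z w : ℂ} (hz : z ∈ disc) (hw : w ∈ disc) :
    1 - (starRingEnd ℂ) z * w ≠ 0 := by
  rw [disc, mem_ball_zero_iff] at hz hw
  intro h
  have : ‖(starRingEnd ℂ) z * w‖ = 1 := by rw [← sub_eq_zero.1 h, norm_one]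
  rw [norm_mul, RCLike.norm_conj] at this
  nlinarith [norm_nonneg z, norm_nonneg w]

/-- The norm of the test functions `w ^ N / (1 - conj z * w)`. -/
theorem lintegral_szego_le (hω : IsRadialWeight ω) {z : ℂ} (hz : z ∈ disc) (N : ℕ) :
    ∫⁻ w, ‖w ^ N / (1 - (starRingEnd ℂ) z * w)‖ₑ ^ 2 ∂(weightMeasure ω) ≤
      ENNReal.ofReal (2 / (1 - ‖z‖)) *
        ∫⁻ s in Ioo 0 1, ENNReal.ofReal (s ^ (2 * N + 1) * ω s) := by
  have hz' : ‖z‖ < 1 := by simpa [disc] using hz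
  rw [lintegral_weightMeasure hω (by fun_prop)]
  rw [← lintegral_const_mul' _ _ ENNReal.ofReal_ne_top,
    ← lintegral_const_mul' _ _ ENNReal.ofReal_ne_top]
  refine setLIntegral_mono' measurableSet_Ioo fun s hs => ?_
  have hs0 : 0 < s := hs.1
  have hs1 : s < 1 := hs.2
  have hω0 := hω.nonneg s hs0.le hs1
  have hnorm : ∀ w ∈ Metric.sphere (0 : ℂ) |s|, ‖w‖ = s := fun w hw => by
    rwa [abs_of_pos hs0, mem_sphere_zero_iff_norm] at hw
  have hsp : ∀ w ∈ Metric.sphere (0 : ℂ) |s|, w ∈ disc := fun w hw => by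
    rw [disc, mem_ball_zero_iff, hnorm w hw]; exact hs1
  have hcont : ContinuousOn (fun w => (‖1 - (starRingEnd ℂ) z * w‖ ^ 2)⁻¹)
      (Metric.sphere 0 |s|) :=
    ContinuousOn.inv₀ (by fun_prop) fun w hw =>
      pow_ne_zero 2 (norm_ne_zero_iff.2 (one_sub_conj_mul_ne_zero hz (hsp w hw)))
  have h1 := lintegral_circle hcont fun w _ => by positivity
  rw [circleAverage_szego hs0 hs1 hz'] at h1
  have h2 : ∀ θ, ‖Complex.polarCoord.symm (s, θ) ^ N /
      (1 - (starRingEnd ℂ) z * Complex.polarCoord.symm (s, θ))‖ₑ ^ 2 =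
      ENNReal.ofReal (s ^ (2 * N)) * ENNReal.ofReal
        ((‖1 - (starRingEnd ℂ) z * Complex.polarCoord.symm (s, θ)‖ ^ 2)⁻¹) := by
    intro θ
    have hn : ‖Complex.polarCoord.symm (s, θ)‖ = s := by
      rw [Complex.norm_polarCoord_symm, abs_of_pos hs0]
    rw [← ENNReal.ofReal_mul (by positivity), ← ofReal_norm, ← ENNReal.ofReal_pow (norm_nonneg _),
      norm_div, norm_pow, hn]
    congr 1
    rw [div_pow, ← pow_mul, mul_comm N 2, div_eq_mul_inv]
  simp only [h2]
  rw [lintegral_const_mul' _ _ ENNReal.ofReal_ne_top, h1,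
    ← ENNReal.ofReal_mul (by positivity), ← ENNReal.ofReal_mul (by positivity),
    ← ENNReal.ofReal_mul (by positivity), ← ENNReal.ofReal_mul (div_nonneg zero_le_two
    (by linarith))]
  refine ENNReal.ofReal_le_ofReal ?_
  have h3 : (1 - s ^ 2 * ‖z‖ ^ 2)⁻¹ ≤ (1 - ‖z‖)⁻¹ := by
    refine inv_anti₀ (by linarith) ?_
    have := norm_nonneg z
    nlinarith [mul_nonneg (sq_nonneg ‖z‖) (show 0 ≤ 1 - s ^ 2 by nlinarith)]
  calc 1 / π * (s * ω s * (s ^ (2 * N) * (2 * π * (1 - s ^ 2 * ‖z‖ ^ 2)⁻¹)))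
      = 2 * (s ^ (2 * N + 1) * ω s) * (1 - s ^ 2 * ‖z‖ ^ 2)⁻¹ := by
        have := pi_pos.ne'
        field_simp
        ring
    _ ≤ 2 * (s ^ (2 * N + 1) * ω s) * (1 - ‖z‖)⁻¹ := by gcongr
    _ = _ := by ring

/-- Lower bound for the norm of the kernel. -/
theorem IsDoubling.exists_one_le_norm_kernel_sq_mul_omegaStar (hω : IsDoubling ω) :
    ∃ C : ℝ, 0 < C ∧ ∀ z ∈ disc, 0 < ‖z‖ → 1 ≤ C * (‖kernel ω z‖ ^ 2 * omegaStar ω z) := by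
  obtain ⟨C, hC⟩ := hω.doubling
  obtain ⟨B, hB⟩ := hω.exists_moment_le
  have := hω.toIsRadialWeight.isFiniteMeasure
  have hone : ∫⁻ w, ‖(fun _ => (1 : ℂ)) w‖ₑ ^ 2 ∂(weightMeasure ω) ≠ ∞ := by simp
  obtain ⟨f₁, hf₁, -⟩ := hω.exists_toFun_eq (differentiableOn_const (c := (1 : ℂ))) hone
  set τ := (tail ω (3 / 4)).toReal with hτ
  have hτ0 : 0 < τ := hω.toReal_tail_pos (by norm_num) (by norm_num)
  -- The first term serves `‖z‖ < 1/2`, tested on the constant `1`; the second serves `‖z‖ ≥ 1/2`;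
  -- the `+ 1` makes positivity immediate.
  refine ⟨4 * ‖f₁‖ ^ 2 / τ + 16 * B * C * Real.exp 4 + 1, by positivity, fun z hz hz0 => ?_⟩
  have hz' : ‖z‖ < 1 := by simpa [disc] using hz
  have hstar := hω.omegaStar_pos hz0 hz'
  have hle := hω.le_omegaStar hz0 hz'
  set K := ‖kernel ω z‖ ^ 2 with hK
  have hK0 : 0 ≤ K := by positivity
  suffices h : 1 ≤ 4 * ‖f₁‖ ^ 2 / τ * (K * omegaStar ω z) ∨
      1 ≤ 16 * B * C * Real.exp 4 * (K * omegaStar ω z) by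
    have h1 : 0 ≤ 4 * ‖f₁‖ ^ 2 / τ * (K * omegaStar ω z) := by positivity
    have h2 : 0 ≤ 16 * B * C * Real.exp 4 * (K * omegaStar ω z) := by positivity
    have h3 : 0 ≤ K * omegaStar ω z := by positivity
    rcases h with h | h <;> linarith
  rcases lt_or_ge ‖z‖ (1 / 2) with hr | hr
  · left
    have h1 := hω.norm_toFun_sq_le hz f₁
    rw [hf₁ hz, norm_one, one_pow, ← hK] at h1
    have h2 : 1 / 4 * τ ≤ omegaStar ω z := by
      refine le_trans ?_ hle
      have : τ ≤ (tail ω ((1 + ‖z‖) / 2)).toReal :=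
        ENNReal.toReal_mono (hω.tail_ne_top (by positivity)) (tail_anti (by linarith))
      exact mul_le_mul (by linarith) this hτ0.le (by linarith)
    calc (1 : ℝ) = 4 / τ * (1 * (1 / 4 * τ)) := by field_simp
      _ ≤ 4 / τ * ((K * ‖f₁‖ ^ 2) * omegaStar ω z) := by gcongr
      _ = _ := by ring
  · right
    set r := ‖z‖ with hrdef
    have h1r : 0 < 1 - r := by linarith
    -- `N` is small enough that `r ^ (2N)` stays above `exp (-4)`, yet large enough that the moment
    -- of order `2N + 1` is bounded by the tail at `r`.
    set N := ⌊(1 - r)⁻¹⌋₊ with hN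
    have hN1 : N * (1 - r) ≤ 1 := by
      have := Nat.floor_le (show 0 ≤ (1 - r)⁻¹ by positivity)
      rw [← hN, ← one_div, le_div_iff₀ h1r] at this
      exact this
    have hN2 : 1 ≤ ((2 * N + 1 : ℕ) : ℝ) * (1 - r) := by
      have := Nat.lt_floor_add_one (1 - r)⁻¹
      rw [← hN, inv_lt_iff_one_lt_mul₀ h1r] at this
      push_cast
      nlinarith [mul_nonneg (Nat.cast_nonneg (α := ℝ) N) h1r.le]
    have hg : DifferentiableOn ℂ (fun w => w ^ N / (1 - (starRingEnd ℂ) z * w)) disc :=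
      DifferentiableOn.div (by fun_prop) (by fun_prop) fun w hw => one_sub_conj_mul_ne_zero hz hw
    have hle2 := (lintegral_szego_le hω.toIsRadialWeight hz N).trans
      (mul_le_mul_right (hB r hz0.le hz' _ hN2) _)
    have hfin : ENNReal.ofReal (2 / (1 - r)) * (B * tail ω r) ≠ ∞ :=
      ENNReal.mul_ne_top ENNReal.ofReal_ne_top
        (ENNReal.mul_ne_top ENNReal.coe_ne_top (hω.tail_ne_top hz0.le))
    obtain ⟨f, hf, hfn⟩ := hω.exists_toFun_eq hg (ne_top_of_le_ne_top hfin hle2)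
    have hfn' : ‖f‖ ^ 2 ≤ 2 / (1 - r) * (B * (tail ω r).toReal) := by
      have := ENNReal.toReal_mono hfin (hfn.le.trans hle2)
      rw [ENNReal.toReal_ofReal (by positivity), ENNReal.toReal_mul, ENNReal.toReal_mul,
        ENNReal.toReal_ofReal (by positivity), ENNReal.coe_toReal] at this
      exact this
    have hev : ‖A2.toFun f z‖ ^ 2 = r ^ (2 * N) / (1 - r ^ 2) ^ 2 := by
      rw [hf hz]
      have h1 : 1 - (starRingEnd ℂ) z * z = ((1 - r ^ 2 : ℝ) : ℂ) := by
        rw [Complex.conj_mul']; push_cast; rfl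
      simp only [h1]
      rw [norm_div, norm_pow, Complex.norm_real, norm_of_nonneg (by nlinarith), div_pow, ← pow_mul,
        mul_comm N 2]
    have hexp : Real.exp (-4) ≤ r ^ (2 * N) := by
      have h1 : Real.exp (-(2 * (1 - r))) ≤ r := by
        have h2 := Real.one_sub_inv_le_log_of_pos hz0
        have h3 : -(2 * (1 - r)) ≤ 1 - r⁻¹ := by
          have : r⁻¹ - 1 = (1 - r) * r⁻¹ := by field_simp
          have h4 : r⁻¹ ≤ 2 := by
            rw [inv_le_comm₀ hz0 (by norm_num)]; linarith
          nlinarith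
        calc _ ≤ Real.exp (Real.log r) := Real.exp_le_exp.2 (h3.trans h2)
          _ = r := Real.exp_log hz0
      calc Real.exp (-4) ≤ Real.exp (((2 * N : ℕ) : ℝ) * -(2 * (1 - r))) := by
            refine Real.exp_le_exp.2 ?_
            push_cast
            nlinarith
        _ = Real.exp (-(2 * (1 - r))) ^ (2 * N) := Real.exp_nat_mul _ _
        _ ≤ r ^ (2 * N) := pow_le_pow_left₀ (Real.exp_pos _).le h1 _
    have hmain := hω.norm_toFun_sq_le hz f
    rw [hev, ← hK] at hmain
    have hsq : (1 - r ^ 2) ^ 2 ≤ 4 * (1 - r) ^ 2 := by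
      have h0 : 1 - r ^ 2 = (1 - r) * (1 + r) := by ring
      rw [h0, mul_pow, mul_comm]
      gcongr
      nlinarith
    have hsqpos : 0 < (1 - r ^ 2) ^ 2 := by
      have : 0 < 1 - r ^ 2 := by nlinarith
      positivity
    have h5 : Real.exp (-4) ≤ 8 * B * K * ((1 - r) * (tail ω r).toReal) := by
      have h6 : Real.exp (-4) / (4 * (1 - r) ^ 2) ≤
          K * (2 / (1 - r) * (B * (tail ω r).toReal)) := by
        calc _ ≤ r ^ (2 * N) / (1 - r ^ 2) ^ 2 := by gcongr
          _ ≤ K * ‖f‖ ^ 2 := hmain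
          _ ≤ _ := by gcongr
      rw [div_le_iff₀ (by positivity)] at h6
      refine h6.trans (le_of_eq ?_)
      field_simp
      ring
    have h7 : (tail ω r).toReal ≤ C * (tail ω ((1 + r) / 2)).toReal := by
      have := ENNReal.toReal_mono (ENNReal.mul_ne_top ENNReal.coe_ne_top
        (hω.tail_ne_top (by positivity))) (hC r hz0.le hz')
      simpa using this
    have h8 : (1 - r) * (tail ω r).toReal ≤ 2 * C * omegaStar ω z := by
      calc _ ≤ (1 - r) * (C * (tail ω ((1 + r) / 2)).toReal) := by gcongr
        _ = 2 * C * ((1 - r) / 2 * (tail ω ((1 + r) / 2)).toReal) := by ring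
        _ ≤ _ := by gcongr
    calc (1 : ℝ) = Real.exp 4 * Real.exp (-4) := by rw [← Real.exp_add]; simp
      _ ≤ Real.exp 4 * (8 * B * K * (2 * C * omegaStar ω z)) := by
        gcongr
        exact h5.trans (by gcongr)
      _ = _ := by ring

end KernelEstimates

/-! ### Parseval and countability of orthonormal bases -/

section HilbertBasis

variable {H : Type} [NormedAddCommGroup H] [InnerProductSpace ℂ H]

theorem ofReal_norm_sq_eq_tsum {ι : Type} (e : HilbertBasis ι ℂ H) (x : H) :
    ENNReal.ofReal (‖x‖ ^ 2) = ∑' i, ‖inner ℂ (e i) x‖ₑ ^ 2 := by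
  have h := e.hasSum_inner_mul_inner x x
  have h1 : ∀ i, inner ℂ x (e i) * inner ℂ (e i) x = ((‖inner ℂ (e i) x‖ ^ 2 : ℝ) : ℂ) := by
    intro i
    rw [← inner_conj_symm x (e i), Complex.conj_mul']
    push_cast
    rfl
  have h2 : inner ℂ x x = ((‖x‖ ^ 2 : ℝ) : ℂ) := by
    rw [inner_self_eq_norm_sq_to_K]
    push_cast
    rfl
  simp only [h1, h2] at h
  have h3 := Complex.hasSum_ofReal.1 h
  rw [← h3.tsum_eq, ENNReal.ofReal_tsum_of_nonneg (fun i => by positivity) h3.summable]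
  refine tsum_congr fun i => ?_
  rw [ENNReal.ofReal_pow (norm_nonneg _), ofReal_norm]

/-- Basis vectors are at distance `√2`, so the balls of radius `1/2` around them are disjoint.
Countability is what permits exchanging sums over the basis with integrals. -/
theorem countable_of_hilbertBasis [SecondCountableTopology H] {ι : Type}
    (e : HilbertBasis ι ℂ H) : Countable ι := by
  have hdist : ∀ i j, i ≠ j → 1 < ‖e i - e j‖ := by
    intro i j hij
    have h : ‖e i - e j‖ ^ 2 = 2 := by
      rw [@norm_sub_sq ℂ, e.orthonormal.1, e.orthonormal.1, e.orthonormal.2 hij]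
      norm_num
    by_contra! hle
    nlinarith [norm_nonneg (e i - e j)]
  have hdisj : (Set.univ : Set ι).PairwiseDisjoint fun i => Metric.ball (e i) (1 / 2) := by
    intro i _ j _ hij
    refine Metric.ball_disjoint_ball ?_
    rw [dist_eq_norm]
    linarith [hdist i j hij]
  have := hdisj.countable_of_isOpen (fun _ _ => Metric.isOpen_ball)
    (fun i _ => ⟨e i, Metric.mem_ball_self (by norm_num)⟩)
  exact Set.countable_univ_iff.1 this

end HilbertBasis

/-! ### Trace formula and comparison of the two integrals -/

section Berezin

open Real Set

variable {ω : ℝ → ℝ}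

attribute [local instance] A2.hilbertInner

/-- No assumption on `z` is needed: if the kernel is zero, both sides are `0`. -/
theorem berezin_eq {T S : A2 ω →L[ℂ] A2 ω} (hS : ∀ x y, inner ℂ (S x) y = inner ℂ x (S y))
    (hST : ∀ x, S (S x) = T x) (z : ℂ) :
    berezin T z = ((‖S (kernel ω z)‖ ^ 2 / ‖kernel ω z‖ ^ 2 : ℝ) : ℂ) := by
  have h := re_inner_eq_norm_sq hS hST (normalizedKernel ω z)
  refine h.trans ?_
  rw [normalizedKernel, map_smul, norm_smul, norm_inv, Complex.norm_real, norm_norm, mul_pow,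
    inv_pow, inv_mul_eq_div]

theorem berezin_mul_norm_kernel_sq {T S : A2 ω →L[ℂ] A2 ω}
    (hS : ∀ x y, inner ℂ (S x) y = inner ℂ x (S y)) (hST : ∀ x, S (S x) = T x) (z : ℂ) :
    berezin T z * (‖kernel ω z‖ : ℂ) ^ 2 = ((‖S (kernel ω z)‖ ^ 2 : ℝ) : ℂ) := by
  rw [berezin_eq hS hST, ← Complex.ofReal_pow, ← Complex.ofReal_mul]
  congr 1
  by_cases h : kernel ω z = 0
  · simp [h]
  · have : ‖kernel ω z‖ ≠ 0 := norm_ne_zero_iff.2 h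
    field_simp

theorem berezin_re_mul_norm_kernel_sq {T S : A2 ω →L[ℂ] A2 ω}
    (hS : ∀ x y, inner ℂ (S x) y = inner ℂ x (S y)) (hST : ∀ x, S (S x) = T x) (z : ℂ) :
    (berezin T z).re * ‖kernel ω z‖ ^ 2 = ‖S (kernel ω z)‖ ^ 2 := by
  have h := congrArg Complex.re (berezin_mul_norm_kernel_sq hS hST z)
  rwa [← Complex.ofReal_pow, Complex.re_mul_ofReal, Complex.ofReal_re] at h

/-- Parseval for `S B_z`: by symmetry and the reproducing property, its coefficient along `e i` is
the conjugate of `(S e_i)(z)`. -/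
theorem IsDoubling.ofReal_norm_apply_kernel_sq (hω : IsDoubling ω) {S : A2 ω →L[ℂ] A2 ω}
    (hS : ∀ x y, inner ℂ (S x) y = inner ℂ x (S y)) {ι : Type} (e : HilbertBasis ι ℂ (A2 ω))
    {z : ℂ} (hz : z ∈ disc) :
    ENNReal.ofReal (‖S (kernel ω z)‖ ^ 2) = ∑' i, ‖A2.toFun (S (e i)) z‖ₑ ^ 2 := by
  rw [ofReal_norm_sq_eq_tsum e]
  refine tsum_congr fun i => ?_
  have h : inner ℂ (e i) (S (kernel ω z)) = (starRingEnd ℂ) (A2.toFun (S (e i)) z) := by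
    rw [← hω.inner_kernel hz, inner_conj_symm]
    exact (hS _ _).symm
  have h' : ‖inner ℂ (e i) (S (kernel ω z))‖ₑ = ‖A2.toFun (S (e i)) z‖ₑ := by
    rw [h, ← ofReal_norm, RCLike.norm_conj, ofReal_norm]
  exact congrArg (· ^ 2) h'

theorem IsDoubling.secondCountableTopology (hω : IsDoubling ω) :
    SecondCountableTopology (A2 ω) := by
  have := hω.toIsRadialWeight.isFiniteMeasure
  have : Fact ((2 : ℝ≥0∞) ≠ ∞) := ⟨by norm_num⟩
  exact TopologicalSpace.Subtype.secondCountableTopology _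

theorem IsDoubling.exists_hilbertBasis (hω : IsDoubling ω) :
    ∃ ι : Type, Nonempty (HilbertBasis ι ℂ (A2 ω)) := by
  have := hω.completeSpace
  obtain ⟨w, b, -⟩ := _root_.exists_hilbertBasis ℂ (A2 ω)
  exact ⟨w, ⟨b⟩⟩

theorem aemeasurable_enorm_toFun_sq (f : A2 ω) :
    AEMeasurable (fun z => ‖A2.toFun f z‖ₑ ^ 2) area := by
  have h := (measurable_indicator_disc (A2.differentiableOn_toFun f).continuousOn).enorm.pow_const 2
  refine h.aemeasurable.congr ?_
  filter_upwards [ae_mem_disc] with z hz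
  rw [indicator_of_mem hz]

/-- The kernel is chosen separately at each point, so measurability is obtained from the countable
Parseval sum of analytic functions. -/
theorem IsDoubling.aemeasurable_norm_apply_kernel_sq (hω : IsDoubling ω) {S : A2 ω →L[ℂ] A2 ω}
    (hS : ∀ x y, inner ℂ (S x) y = inner ℂ x (S y)) :
    AEMeasurable (fun z => ‖S (kernel ω z)‖ ^ 2) area := by
  obtain ⟨ι, ⟨e⟩⟩ := hω.exists_hilbertBasis
  have := hω.secondCountableTopology
  have := countable_of_hilbertBasis e
  have h : AEMeasurable (fun z => ∑' i, ‖A2.toFun (S (e i)) z‖ₑ ^ 2) area :=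
    AEMeasurable.tsum fun i => aemeasurable_enorm_toFun_sq (S (e i))
  refine h.ennreal_toReal.congr ?_
  filter_upwards [ae_mem_disc] with z hz
  rw [← hω.ofReal_norm_apply_kernel_sq hS e hz, ENNReal.toReal_ofReal (by positivity)]

theorem IsDoubling.aestronglyMeasurable_berezin (hω : IsDoubling ω) {T : A2 ω →L[ℂ] A2 ω}
    (hT : T.IsPositive) : AEStronglyMeasurable (berezin T) area := by
  have := hω.completeSpace
  obtain ⟨S, hS, hST⟩ := exists_sqrt hT
  have h1 := hω.aemeasurable_norm_apply_kernel_sq hS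
  -- `S = id` gives the measurability of `‖B_z‖²`.
  have h2 := hω.aemeasurable_norm_apply_kernel_sq (S := ContinuousLinearMap.id ℂ (A2 ω))
    fun _ _ => rfl
  have h3 : berezin T = fun z => ((‖S (kernel ω z)‖ ^ 2 / ‖kernel ω z‖ ^ 2 : ℝ) : ℂ) :=
    funext fun z => berezin_eq hS hST z
  rw [h3]
  exact (Complex.measurable_ofReal.comp_aemeasurable (h1.div h2)).aestronglyMeasurable

/-- The set `s` is left free: the whole plane gives the trace formula, `‖z‖ > 1/2` and its
complement serve the comparison. -/
theorem IsDoubling.lintegral_norm_apply_kernel_sq (hω : IsDoubling ω) {S : A2 ω →L[ℂ] A2 ω}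
    (hS : ∀ x y, inner ℂ (S x) y = inner ℂ x (S y)) {ι : Type} (e : HilbertBasis ι ℂ (A2 ω))
    (s : Set ℂ) :
    ∫⁻ z in s, ENNReal.ofReal (‖S (kernel ω z)‖ ^ 2) ∂(weightMeasure ω) =
      ∑' i, ∫⁻ z in s, ‖A2.toFun (S (e i)) z‖ₑ ^ 2 ∂(weightMeasure ω) := by
  have := hω.secondCountableTopology
  have := countable_of_hilbertBasis e
  have hac : (weightMeasure ω).restrict s ≪ area :=
    Measure.restrict_le_self.absolutelyContinuous.trans (withDensity_absolutelyContinuous _ _)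
  rw [← lintegral_tsum fun i => (aemeasurable_enorm_toFun_sq (S (e i))).mono_ac hac]
  refine lintegral_congr_ae (ae_restrict_of_ae ?_)
  filter_upwards [ae_weightMeasure_mem_disc] with z hz
  exact hω.ofReal_norm_apply_kernel_sq hS e hz

/-- The trace formula for positive operators. -/
theorem IsDoubling.tsum_inner_eq_lintegral (hω : IsDoubling ω) {T : A2 ω →L[ℂ] A2 ω}
    (hT : T.IsPositive) {ι : Type} (e : HilbertBasis ι ℂ (A2 ω)) :
    ∑' i, ENNReal.ofReal (inner ℂ (e i) (T (e i))).re =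
      ∫⁻ z, ENNReal.ofReal ((berezin T z).re * ‖kernel ω z‖ ^ 2) ∂(weightMeasure ω) := by
  have := hω.completeSpace
  obtain ⟨S, hS, hST⟩ := exists_sqrt hT
  simp only [berezin_re_mul_norm_kernel_sq hS hST]
  rw [← setLIntegral_univ, hω.lintegral_norm_apply_kernel_sq hS e]
  refine tsum_congr fun i => ?_
  rw [setLIntegral_univ, ← A2.ofReal_norm_sq]
  have h := re_inner_eq_norm_sq hS hST (e i)
  have h' := congrArg Complex.re h
  rw [Complex.ofReal_re] at h'
  exact congrArg ENNReal.ofReal h'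

/-- The mass of an analytic function near the origin is controlled by the mass near the
boundary. -/
theorem IsDoubling.exists_lintegral_compl_le (hω : IsDoubling ω) :
    ∃ D : ℝ≥0, ∀ f : ℂ → ℂ, DifferentiableOn ℂ f disc →
      ∫⁻ z in {z | 1 / 2 < ‖z‖}ᶜ, ‖f z‖ₑ ^ 2 ∂(weightMeasure ω) ≤
        D * ∫⁻ z in {z | 1 / 2 < ‖z‖}, ‖f z‖ₑ ^ 2 ∂(weightMeasure ω) := by
  have := hω.toIsRadialWeight.isFiniteMeasure
  -- The constant of the point estimate at `‖z‖ = 1/2`, the smallest over `‖z‖ ≤ 1/2`.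
  set κ := ENNReal.ofReal (1 / 8) * tail ω (3 / 4) with hκ
  have hκ0 : κ ≠ 0 := mul_ne_zero (by simp) (hω.tail_pos _ (by norm_num) (by norm_num)).ne'
  have hκt : κ ≠ ∞ := ENNReal.mul_ne_top ENNReal.ofReal_ne_top (hω.tail_ne_top (by norm_num))
  have hfin : κ⁻¹ * weightMeasure ω univ ≠ ∞ :=
    ENNReal.mul_ne_top (ENNReal.inv_ne_top.2 hκ0) (measure_ne_top _ _)
  refine ⟨(κ⁻¹ * weightMeasure ω univ).toNNReal, fun f hf => ?_⟩
  rw [ENNReal.coe_toNNReal hfin]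
  set J := ∫⁻ z in {z | 1 / 2 < ‖z‖}, ‖f z‖ₑ ^ 2 ∂(weightMeasure ω) with hJ
  have hms : MeasurableSet {z : ℂ | 1 / 2 < ‖z‖}ᶜ :=
    (measurableSet_lt measurable_const (by fun_prop)).compl
  have hpt : ∀ z ∈ {z : ℂ | 1 / 2 < ‖z‖}ᶜ, ‖f z‖ₑ ^ 2 ≤ κ⁻¹ * J := by
    intro z hz
    have hz2 : ‖z‖ ≤ 1 / 2 := not_lt.1 hz
    have h1 := hω.toIsRadialWeight.enorm_sq_le hf (z := z) (by linarith)
    rw [← ENNReal.mul_le_iff_le_inv hκ0 hκt]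
    calc κ * ‖f z‖ₑ ^ 2 = ENNReal.ofReal (1 / 8 * ‖f z‖ ^ 2) * tail ω (3 / 4) := by
          rw [hκ, ENNReal.ofReal_mul (by norm_num), ENNReal.ofReal_pow (norm_nonneg _),
            ofReal_norm]
          ring
      _ ≤ ENNReal.ofReal ((1 - ‖z‖) / 4 * ‖f z‖ ^ 2) * tail ω ((1 + ‖z‖) / 2) := by
          refine mul_le_mul' (ENNReal.ofReal_le_ofReal ?_) (tail_anti (by linarith))
          exact mul_le_mul_of_nonneg_right (by linarith) (by positivity)
      _ ≤ _ := h1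
      _ ≤ J := by
          refine lintegral_mono_set fun w hw => ?_
          have hw' : (1 + ‖z‖) / 2 < ‖w‖ := hw
          show 1 / 2 < ‖w‖
          linarith [norm_nonneg z]
  calc _ ≤ ∫⁻ _ in {z : ℂ | 1 / 2 < ‖z‖}ᶜ, κ⁻¹ * J ∂(weightMeasure ω) :=
        setLIntegral_mono' hms hpt
    _ = κ⁻¹ * J * weightMeasure ω {z : ℂ | 1 / 2 < ‖z‖}ᶜ := setLIntegral_const _ _
    _ ≤ κ⁻¹ * J * weightMeasure ω univ := by gcongr; exact subset_univ _
    _ = _ := by ring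

theorem lintegral_weightMeasure_eq (hω : IsRadialWeight ω) {g : ℂ → ℝ≥0∞}
    (hg : AEMeasurable g area) : ∫⁻ z, g z ∂(weightMeasure ω) =
      ∫⁻ z, ENNReal.ofReal (ω ‖z‖) * g z ∂area :=
  lintegral_withDensity_eq_lintegral_mul₀ hω.aemeasurable_norm.ennreal_ofReal hg

theorem lintegral_quotientMeasure_eq (hω : IsRadialWeight ω) {g : ℂ → ℝ≥0∞}
    (hg : AEMeasurable g area) : ∫⁻ z, g z ∂(quotientMeasure ω) =
      ∫⁻ z, ENNReal.ofReal (ω ‖z‖ / omegaStar ω z) * g z ∂area :=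
  lintegral_withDensity_eq_lintegral_mul₀
    (hω.aemeasurable_norm.div hω.measurable_omegaStar.aemeasurable).ennreal_ofReal hg

/-- The origin must be discarded because `omegaStar ω 0 = 0` by the conventions for division and
logarithm. -/
theorem ae_norm_pos : ∀ᵐ z ∂area, 0 < ‖z‖ := by
  have h : ∀ᵐ z : ℂ, z ≠ 0 := by simp [ae_iff]
  filter_upwards [Measure.ae_smul_measure (ae_restrict_of_ae (s := disc) h)
    (ENNReal.ofReal (1 / π))] with z hz
  exact norm_pos_iff.2 hz

/-- The lower kernel bound holds on the whole punctured disc, so the integrands compare pointwise.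
-/
theorem IsDoubling.exists_lintegral_quotientMeasure_le (hω : IsDoubling ω) :
    ∃ C : ℝ, 0 < C ∧ ∀ T : A2 ω →L[ℂ] A2 ω, T.IsPositive →
      ∫⁻ z, ENNReal.ofReal (berezin T z).re ∂(quotientMeasure ω) ≤ ENNReal.ofReal C *
        ∫⁻ z, ENNReal.ofReal ((berezin T z).re * ‖kernel ω z‖ ^ 2) ∂(weightMeasure ω) := by
  have := hω.completeSpace
  obtain ⟨C, hC0, hC⟩ := hω.exists_one_le_norm_kernel_sq_mul_omegaStar
  refine ⟨C, hC0, fun T hT => ?_⟩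
  obtain ⟨S, hS, hST⟩ := exists_sqrt hT
  have hm1 : AEMeasurable (fun z => ENNReal.ofReal (berezin T z).re) area :=
    (Complex.measurable_re.comp_aemeasurable
      (hω.aestronglyMeasurable_berezin hT).aemeasurable).ennreal_ofReal
  have hm2 := (hω.aemeasurable_norm_apply_kernel_sq hS).ennreal_ofReal
  simp only [← berezin_re_mul_norm_kernel_sq hS hST] at hm2
  rw [lintegral_quotientMeasure_eq hω.toIsRadialWeight hm1,
    lintegral_weightMeasure_eq hω.toIsRadialWeight hm2,
    ← lintegral_const_mul' _ _ ENNReal.ofReal_ne_top]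
  refine lintegral_mono_ae ?_
  filter_upwards [ae_mem_disc, ae_norm_pos] with z hz hz0
  have hz' : ‖z‖ < 1 := by simpa [disc] using hz
  have hω0 := hω.nonneg _ (norm_nonneg z) hz'
  have hstar := hω.omegaStar_pos hz0 hz'
  have hb : 0 ≤ (berezin T z).re := by
    rw [berezin_eq hS hST, Complex.ofReal_re]; positivity
  rw [← ENNReal.ofReal_mul (by positivity), ← ENNReal.ofReal_mul hω0, ← ENNReal.ofReal_mul hC0.le]
  refine ENNReal.ofReal_le_ofReal ?_
  rw [div_mul_eq_mul_div, div_le_iff₀ hstar]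
  calc ω ‖z‖ * (berezin T z).re = ω ‖z‖ * (berezin T z).re * 1 := (mul_one _).symm
    _ ≤ ω ‖z‖ * (berezin T z).re * (C * (‖kernel ω z‖ ^ 2 * omegaStar ω z)) := by
        gcongr; exact hC z hz hz0
    _ = _ := by ring

/-- The upper kernel bound is available only for `‖z‖ ≥ 1/2`. The inner part is first moved outward
for each analytic `S e_i` and summed over the basis; the pointwise comparison then applies. -/
theorem IsDoubling.exists_lintegral_weightMeasure_le (hω : IsDoubling ω) :
    ∃ C : ℝ, 0 < C ∧ ∀ T : A2 ω →L[ℂ] A2 ω, T.IsPositive →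
      ∫⁻ z, ENNReal.ofReal ((berezin T z).re * ‖kernel ω z‖ ^ 2) ∂(weightMeasure ω) ≤
        ENNReal.ofReal C * ∫⁻ z, ENNReal.ofReal (berezin T z).re ∂(quotientMeasure ω) := by
  have := hω.completeSpace
  obtain ⟨C, hC0, hC⟩ := hω.exists_norm_kernel_sq_mul_omegaStar_le
  obtain ⟨D, hD⟩ := hω.exists_lintegral_compl_le
  refine ⟨(D + 1) * C, by positivity, fun T hT => ?_⟩
  obtain ⟨S, hS, hST⟩ := exists_sqrt hT
  obtain ⟨ι, ⟨e⟩⟩ := hω.exists_hilbertBasis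
  have hms : MeasurableSet {z : ℂ | 1 / 2 < ‖z‖} :=
    measurableSet_lt measurable_const (by fun_prop)
  have hm1 : AEMeasurable (fun z => ENNReal.ofReal (berezin T z).re) area :=
    (Complex.measurable_re.comp_aemeasurable
      (hω.aestronglyMeasurable_berezin hT).aemeasurable).ennreal_ofReal
  have hm2 := (hω.aemeasurable_norm_apply_kernel_sq hS).ennreal_ofReal
  have h1 : ∫⁻ z, ENNReal.ofReal (‖S (kernel ω z)‖ ^ 2) ∂(weightMeasure ω) ≤
      (D + 1 : ℝ≥0) * ∫⁻ z in {z | 1 / 2 < ‖z‖}, ENNReal.ofReal (‖S (kernel ω z)‖ ^ 2)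
        ∂(weightMeasure ω) := by
    rw [← lintegral_add_compl _ hms, hω.lintegral_norm_apply_kernel_sq hS e {z | 1 / 2 < ‖z‖},
      hω.lintegral_norm_apply_kernel_sq hS e {z | 1 / 2 < ‖z‖}ᶜ, add_comm, ENNReal.coe_add,
      ENNReal.coe_one, add_mul, one_mul, ← ENNReal.tsum_mul_left]
    gcongr
    exact hD _ (A2.differentiableOn_toFun _)
  have h2 : ∫⁻ z in {z | 1 / 2 < ‖z‖}, ENNReal.ofReal (‖S (kernel ω z)‖ ^ 2)
      ∂(weightMeasure ω) ≤
      ENNReal.ofReal C * ∫⁻ z, ENNReal.ofReal (berezin T z).re ∂(quotientMeasure ω) := by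
    rw [← lintegral_indicator hms, lintegral_weightMeasure_eq hω.toIsRadialWeight
      (hm2.indicator hms), lintegral_quotientMeasure_eq hω.toIsRadialWeight hm1,
      ← lintegral_const_mul' _ _ ENNReal.ofReal_ne_top]
    refine lintegral_mono_ae ?_
    filter_upwards [ae_mem_disc] with z hz
    by_cases hz2 : z ∈ {z : ℂ | 1 / 2 < ‖z‖}
    · have hz' : ‖z‖ < 1 := by simpa [disc] using hz
      have hz2' : 1 / 2 < ‖z‖ := hz2
      have hω0 := hω.nonneg _ (norm_nonneg z) hz'
      have hstar := hω.omegaStar_pos (show 0 < ‖z‖ by linarith) hz'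
      have hb : 0 ≤ (berezin T z).re := by
        rw [berezin_eq hS hST, Complex.ofReal_re]; positivity
      rw [indicator_of_mem hz2, ← berezin_re_mul_norm_kernel_sq hS hST,
        ← ENNReal.ofReal_mul hω0, ← ENNReal.ofReal_mul (by positivity),
        ← ENNReal.ofReal_mul hC0.le]
      refine ENNReal.ofReal_le_ofReal ?_
      have h3 := hC z hz hz2'.le
      rw [div_mul_eq_mul_div, mul_div_assoc', le_div_iff₀ hstar]
      calc _ = ω ‖z‖ * (berezin T z).re * (‖kernel ω z‖ ^ 2 * omegaStar ω z) := by ring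
        _ ≤ ω ‖z‖ * (berezin T z).re * C := by gcongr
        _ = _ := by ring
    · rw [indicator_of_notMem hz2, mul_zero]
      exact zero_le
  simp only [berezin_re_mul_norm_kernel_sq hS hST]
  calc _ ≤ _ := h1
    _ ≤ (D + 1 : ℝ≥0) * (ENNReal.ofReal C *
        ∫⁻ z, ENNReal.ofReal (berezin T z).re ∂(quotientMeasure ω)) := by gcongr
    _ = _ := by
      rw [← mul_assoc, ENNReal.ofReal_mul (by positivity), ← ENNReal.ofReal_coe_nnreal]
      simp

theorem IsDoubling.isTraceClass_iff_lintegral_ne_top (hω : IsDoubling ω)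
    {T : A2 ω →L[ℂ] A2 ω} (hT : T.IsPositive) : IsTraceClass T ↔
      ∫⁻ z, ENNReal.ofReal ((berezin T z).re * ‖kernel ω z‖ ^ 2) ∂(weightMeasure ω) ≠ ∞ := by
  have := hω.completeSpace
  obtain ⟨ι, ⟨e⟩⟩ := hω.exists_hilbertBasis
  rw [isTraceClass_iff_tsum_ne_top hT e, ← hω.tsum_inner_eq_lintegral hT e]

/-- The Berezin transform of a positive operator is real and nonnegative, so its real part equals
its norm. -/
theorem IsDoubling.integrable_berezin_iff (hω : IsDoubling ω)
    {T : A2 ω →L[ℂ] A2 ω} (hT : T.IsPositive) : Integrable (berezin T) (quotientMeasure ω) ↔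
      ∫⁻ z, ENNReal.ofReal (berezin T z).re ∂(quotientMeasure ω) ≠ ∞ := by
  have := hω.completeSpace
  obtain ⟨S, hS, hST⟩ := exists_sqrt hT
  have h : ∫⁻ z, ENNReal.ofReal (berezin T z).re ∂(quotientMeasure ω) =
      ∫⁻ z, ‖berezin T z‖ₑ ∂(quotientMeasure ω) := by
    refine lintegral_congr fun z => ?_
    rw [berezin_eq hS hST, Complex.ofReal_re, ← ofReal_norm, Complex.norm_real,
      norm_of_nonneg (by positivity)]
  rw [h, ← lt_top_iff_ne_top]
  exact ⟨fun h => h.2, fun h' => ⟨(hω.aestronglyMeasurable_berezin hT).mono_ac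
    (withDensity_absolutelyContinuous _ _), h'⟩⟩

theorem IsDoubling.integrable_and_hasTrace (hω : IsDoubling ω) {T : A2 ω →L[ℂ] A2 ω}
    (hT : T.IsPositive) (htr : IsTraceClass T) :
    Integrable (fun z => berezin T z * (‖kernel ω z‖ : ℂ) ^ 2) (weightMeasure ω) ∧
      HasTrace T (∫ z, berezin T z * (‖kernel ω z‖ : ℂ) ^ 2 ∂(weightMeasure ω)) := by
  have := hω.completeSpace
  obtain ⟨S, hS, hST⟩ := exists_sqrt hT
  have hfin := (hω.isTraceClass_iff_lintegral_ne_top hT).1 htr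
  have hm : AEStronglyMeasurable (fun z => ‖S (kernel ω z)‖ ^ 2) (weightMeasure ω) :=
    ((hω.aemeasurable_norm_apply_kernel_sq hS).mono_ac
      (withDensity_absolutelyContinuous _ _)).aestronglyMeasurable
  have htsum := fun ι (e : HilbertBasis ι ℂ (A2 ω)) => hω.tsum_inner_eq_lintegral hT e
  simp only [berezin_re_mul_norm_kernel_sq hS hST] at hfin htsum
  simp only [berezin_mul_norm_kernel_sq hS hST]
  have hint : Integrable (fun z => ‖S (kernel ω z)‖ ^ 2) (weightMeasure ω) := by
    refine ⟨hm, ?_⟩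
    rw [hasFiniteIntegral_iff_ofReal (Filter.Eventually.of_forall fun z => by positivity)]
    exact hfin.lt_top
  refine ⟨hint.ofReal, hω.exists_hilbertBasis, fun ι e => ?_⟩
  have hcoe : ∫ z, ((‖S (kernel ω z)‖ ^ 2 : ℝ) : ℂ) ∂(weightMeasure ω) =
      ((∫ z, ‖S (kernel ω z)‖ ^ 2 ∂(weightMeasure ω) : ℝ) : ℂ) := integral_ofReal
  rw [hcoe, integral_eq_lintegral_of_nonneg_ae
    (Filter.Eventually.of_forall fun z => by positivity) hm, ← htsum ι e]
  have hin : ∀ i, inner ℂ (e i) (T (e i)) = ((‖S (e i)‖ ^ 2 : ℝ) : ℂ) := fun i =>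
    re_inner_eq_norm_sq hS hST (e i)
  have hne := hfin
  rw [← htsum ι e] at hne
  have hsum := ENNReal.hasSum_toReal hne
  rw [← ENNReal.tsum_toReal_eq fun i => ENNReal.ofReal_ne_top] at hsum
  simp only [hin, Complex.ofReal_re] at hsum ⊢
  have h2 : ∀ i, (ENNReal.ofReal (‖S (e i)‖ ^ 2)).toReal = ‖S (e i)‖ ^ 2 := fun i =>
    ENNReal.toReal_ofReal (by positivity)
  simp only [h2] at hsum
  exact Complex.hasSum_ofReal.2 hsum

end Berezin
end Bergman

theorem mainTheorem6 (ω : ℝ → ℝ) (hω : Bergman.IsDoubling ω) :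
    (∀ T : Bergman.A2 ω →L[ℂ] Bergman.A2 ω, T.IsPositive →
      -- membership in the trace class
      (Bergman.IsTraceClass T ↔
        Integrable (Bergman.berezin T) (Bergman.quotientMeasure ω)) ∧
      -- the trace formula for trace class operators
      (Bergman.IsTraceClass T →
        Integrable (fun z => Bergman.berezin T z * (‖Bergman.kernel ω z‖ : ℂ) ^ 2)
          (Bergman.weightMeasure ω) ∧
        Bergman.HasTrace T
          (∫ z, Bergman.berezin T z * (‖Bergman.kernel ω z‖ : ℂ) ^ 2
            ∂(Bergman.weightMeasure ω))) ∧
      -- the trace formula in `[0, ∞]` for all positive operators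
      Bergman.HasExtendedTrace T
        (∫⁻ z, ENNReal.ofReal ((Bergman.berezin T z).re * ‖Bergman.kernel ω z‖ ^ 2)
          ∂(Bergman.weightMeasure ω))) ∧
    -- the comparison, with constants that depend only on the weight
    (∃ c C : ℝ, 0 < c ∧ 0 < C ∧
      ∀ T : Bergman.A2 ω →L[ℂ] Bergman.A2 ω, T.IsPositive →
        ENNReal.ofReal c *
            ∫⁻ z, ENNReal.ofReal (Bergman.berezin T z).re ∂(Bergman.quotientMeasure ω) ≤
          ∫⁻ z, ENNReal.ofReal ((Bergman.berezin T z).re * ‖Bergman.kernel ω z‖ ^ 2)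
            ∂(Bergman.weightMeasure ω) ∧
        ∫⁻ z, ENNReal.ofReal ((Bergman.berezin T z).re * ‖Bergman.kernel ω z‖ ^ 2)
            ∂(Bergman.weightMeasure ω) ≤
          ENNReal.ofReal C *
            ∫⁻ z, ENNReal.ofReal (Bergman.berezin T z).re ∂(Bergman.quotientMeasure ω)) := by
  obtain ⟨C₁, hC₁, h₁⟩ := hω.exists_lintegral_quotientMeasure_le
  obtain ⟨C₂, hC₂, h₂⟩ := hω.exists_lintegral_weightMeasure_le
  refine ⟨fun T hT => ⟨?_, hω.integrable_and_hasTrace hT, hω.exists_hilbertBasis,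
    fun ι e => hω.tsum_inner_eq_lintegral hT e⟩, C₁⁻¹, C₂, inv_pos.2 hC₁, hC₂,
    fun T hT => ⟨?_, h₂ T hT⟩⟩
  · rw [hω.isTraceClass_iff_lintegral_ne_top hT, hω.integrable_berezin_iff hT]
    exact ⟨fun h => ne_top_of_le_ne_top (ENNReal.mul_ne_top ENNReal.ofReal_ne_top h) (h₁ T hT),
      fun h => ne_top_of_le_ne_top (ENNReal.mul_ne_top ENNReal.ofReal_ne_top h) (h₂ T hT)⟩
  · calc _ ≤ ENNReal.ofReal C₁⁻¹ * (ENNReal.ofReal C₁ * _) := mul_le_mul_right (h₁ T hT) _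
      _ = _ := by
        rw [← mul_assoc, ← ENNReal.ofReal_mul (inv_pos.2 hC₁).le, inv_mul_cancel₀ hC₁.ne',
          ENNReal.ofReal_one, one_mul]
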